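/- **Asymptotics for Multinomial Logistic Regression.** Fix $\mathcal T\ge 1$, $p_{\min}>0$, $\mathcal X>0$, $\delta>0$. For each $n$ let $P_n$ be a law of $(X,D)$ with $D\in\{0,\dots,\mathcal T\}$, propensity scores $p_t(x)=P_n(D=t\mid X=x)\ge p_{\min}$ for all $t$ (almost every $x$), and let $X^*=R_n(X)\in\mathbb R^{p}$, $p=p_n$, satisfy $\max_j|X^*_j|\le\mathcal X$ a.s. Observe an i.i.d. sample $(x_i,d_i)_{i\le n}$ from $P_n$ and write $x_i^*=R_n(x_i)$, $\mathbb E_n[w_i]=n^{-1}\sum_{i\le n} w_i$. For $w\in\mathbb R^{\mathcal T}$ put $\hat p_t(w)=e^{w_t}/(1+\sum_{u=1}^{\mathcal T}e^{w_u})$; for $\gamma=(\gamma_1,\dots,\gamma_{\mathcal T})\in\mathbb R^{p\mathcal T}$ put $\hat p_t(x_i;\gamma)=\hat p_t((x_i^{*\prime}\gamma_u)_{u\le\mathcal T})$, $|||\gamma_{\cdot,S}|||=\sum_{j\in S}\|\gamma_{\cdot,j}\|_2$, $|||\gamma|||=|||\gamma_{\cdot,\{1,\dots,p\}}|||$, and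 $\mathrm{supp}(\gamma)=\{j:\|\gamma_{\cdot,j}\|_2>0\}$. Let $$\mathcal M(\gamma)=\mathbb E_n\Big[\log\Big(1+\sum_{t=1}^{\mathcal T} e^{x_i^{*\prime}\gamma_t}\Big)-\sum_{t=1}^{\mathcal T}1\{d_i=t\}\,x_i^{*\prime}\gamma_t\Big],\qquad \lambda_D=\frac{2\mathcal X\sqrt{\mathcal T}}{\sqrt n}\Big(1+\frac{\log(p\vee n)^{3/2+\delta}}{\sqrt{\mathcal T}}\Big)^{1/2}.$$ Let $\gamma^*=\gamma^*_n$ be coefficients with $S_*=\mathrm{supp}(\gamma^*)$, $|S_*|=s_d$, and let $b_s^d$ be such that, with probability approaching one (w.p.a.1), $\mathbb E_n[(\hat p_t(x_i;\gamma^*)-p_t(x_i))^2]^{1/2}\le b_s^d$ for $1\le t\le \mathcal T$. Let $\tilde\gamma$ be any minimizer of $\mathcal M(\gamma)+\lambda_D|||\gamma|||$ and $\tilde S^D=\mathrm{supp}(\tilde\gamma)$. Let $Q=\mathbb E_n[x_i^*x_i^{*\prime}]$. Write $\underline\phi\{Q,S\}^2$ and $\overline\phi\{Q,S\}^2$ for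 the minimum and maximum of $v'Qv/\|v\|_2^2$ over $v\ne0$ supported in $S$, and $\overline{\overline\phi}(Q,m)=\max_{|S|\le m}\overline\phi\{Q,S\}$. Assume: (i) $\lambda_D s_d=o(1)$ and $b_s^d\sqrt{s_d}=o(1)$; (ii) there are $\kappa_D=\kappa_{D,n}$, bounded away from zero, such that w.p.a.1 $\kappa_D^2\le\sum_t\delta_t'Q\delta_t/\|\delta_{\cdot,S_*}\|_2^2$ for all $\delta\in\mathbb R^{p\mathcal T}\setminus\{0\}$ with $|||\delta_{\cdot,S_*^c}|||\le4|||\delta_{\cdot,S_*}|||$; (iii) for every $C>0$ there is $c>0$ such that w.p.a.1 $\underline\phi\{Q,S\}\ge c$ for all nonempty $S$ with $|S|\le Cs_d$; and, for some fixed $A_K>2$, there is $C$ such that w.p.a.1 $\overline{\overline\phi}(Q,m)\le C$ for all $m\in\mathbb N_Q^D=\{m\in\{1,\dots,n\}:m>8s_dL_n\overline{\overline\phi}(Q,m)\}$, where $A_p=p_{\min}/(0\vee(p_{\min}-b_s^d))$, $R_{\mathcal M}=(A_p/p_{\min})^{\mathcal T+1}\mathcal T A_K(6\lambda_D\sqrt{s_d}/\kappa_D+8b_s^d\sqrt{\mathcal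 T})$ and $L_n=\mathcal T\big((R_{\mathcal M}+b_s^d)/(\lambda_D\sqrt{s_d})\big)^2$. Then: 1. If $b_s^d=O(\lambda_D\sqrt{s_d})$, then $|\tilde S^D|=O_{P_n}(s_d)$. Moreover, let $\hat S^D$ be any (data-dependent, possibly additionally random) sets of covariates and $\hat\gamma$ coefficients such that w.p.a.1 $\hat S^D\supseteq\tilde S^D$ and $\hat\gamma$ minimizes $\mathcal M$ over the $\gamma$ with $\mathrm{supp}(\gamma)\subseteq\hat S^D$. Suppose that either $|\hat S^D|=O_{P_n}(s_d)$, or $b_s^d=O(\lambda_D\sqrt{s_d})$ and $|\hat S^D\setminus\tilde S^D|=O_{P_n}(s_d)$. Then for each $t\in\{1,\dots,\mathcal T\}$: 2. $\mathbb E_n[(\hat p_t(x_i;\hat\gamma)-p_t(x_i))^2]=O_{P_n}\big(n^{-1}s_d\log(p\vee n)^{3/2+\delta}+(b_s^d)^2\big)$; 3. $\|\hat\gamma_t-\gamma^*_t\|_1=O_{P_n}\big(\sqrt{n^{-1}s_d^2\log(p\vee n)^{3/2+\delta}}+b_s^d\sqrt{s_d}\big)$. -/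

import Mathlib

open MeasureTheory ProbabilityTheory Filter Topology Asymptotics

namespace GroupLassoMLogit

noncomputable section

/-! ### Asymptotic notation along a sequence of probability spaces -/

/-- The events `E n` hold with probability approaching one. -/
def WPA1 {Ω : ℕ → Type*} [∀ n, MeasurableSpace (Ω n)] (μ : ∀ n, Measure (Ω n))
    (E : ∀ n, Set (Ω n)) : Prop :=
  Tendsto (fun n => μ n (E n)ᶜ) atTop (𝓝 0)

/-- `X n = O_{P_n}(a n)`: for each `ε > 0` there is `M` with
`P_n(|X n| > M * a n) ≤ ε` for all large `n`. -/
def IsOP {Ω : ℕ → Type*} [∀ n, MeasurableSpace (Ω n)] (μ : ∀ n, Measure (Ω n))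
    (X : ∀ n, Ω n → ℝ) (a : ℕ → ℝ) : Prop :=
  ∀ ε : ℝ, 0 < ε → ∃ M : ℝ, 0 < M ∧
    ∀ᶠ n in atTop, μ n {ω | M * a n < |X n ω|} ≤ ENNReal.ofReal ε

/-! ### Propensity scores

Treatments are `Fin (T + 1)`, with `0` the baseline; the treatments `1, …, T` are
`t.succ` for `t : Fin T`. -/

/-- The propensity score `p_t(x) = P(D = t | X = x)` of the law `P` of `(X, D)`. -/
def propensity {𝓧 : Type*} [MeasurableSpace 𝓧] {T : ℕ} (P : Measure (𝓧 × Fin (T + 1)))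
    [IsFiniteMeasure P] (t : Fin (T + 1)) (x : 𝓧) : ℝ :=
  (P.condKernel x).real {t}

/-- The multinomial logit function `exp (w_t) / (1 + ∑_u exp (w_u))`, `t = 1, …, T`. -/
def mlogit {T : ℕ} (w : Fin T → ℝ) (t : Fin T) : ℝ :=
  Real.exp (w t) / (1 + ∑ u, Real.exp (w u))

/-! ### Sample quantities

`x i j` is the `j`-th covariate of observation `i`, `d i` its treatment, and a coefficient
collection is `γ : Fin T → Fin p → ℝ`. -/

/-- The empirical mean `𝔼_n[f_i]`. -/
def empMean {n : ℕ} (f : Fin n → ℝ) : ℝ := (∑ i, f i) / n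

/-- The fitted log-odds `(x_i' γ_t)_t`. -/
def logOdds {T p : ℕ} (γ : Fin T → Fin p → ℝ) (xi : Fin p → ℝ) : Fin T → ℝ :=
  fun t => ∑ j, xi j * γ t j

/-- The multinomial logistic loss (average negative log-likelihood)
`𝔼_n[log (1 + ∑_t exp (x_i' γ_t)) - ∑_t 1{d_i = t} x_i' γ_t]`. -/
def mlogitLoss {n T p : ℕ} (x : Fin n → Fin p → ℝ) (d : Fin n → Fin (T + 1))
    (γ : Fin T → Fin p → ℝ) : ℝ :=
  empMean fun i =>
    Real.log (1 + ∑ t, Real.exp (logOdds γ (x i) t))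
      - ∑ t : Fin T, if d i = t.succ then logOdds γ (x i) t else 0

/-- The mixed `ℓ₂/ℓ₁` norm of `δ_{·,S}`: outer sum over covariates in `S`, inner Euclidean norm
over treatments. -/
def mixedNormOn {T p : ℕ} (S : Finset (Fin p)) (δ : Fin T → Fin p → ℝ) : ℝ :=
  ∑ j ∈ S, Real.sqrt (∑ t, δ t j ^ 2)

/-- The union over treatments of the supports, `{j : ‖γ_{·,j}‖₂ > 0}`. -/
def suppUnion {T p : ℕ} (γ : Fin T → Fin p → ℝ) : Finset (Fin p) :=
  {j | 0 < Real.sqrt (∑ t, γ t j ^ 2)}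

/-- `γ` is a group lasso estimate with penalty level `lam`. -/
def IsGroupLasso {n T p : ℕ} (x : Fin n → Fin p → ℝ) (d : Fin n → Fin (T + 1)) (lam : ℝ)
    (γ : Fin T → Fin p → ℝ) : Prop :=
  ∀ γ' : Fin T → Fin p → ℝ,
    mlogitLoss x d γ + lam * mixedNormOn Finset.univ γ
      ≤ mlogitLoss x d γ' + lam * mixedNormOn Finset.univ γ'

/-- `γ` is an unpenalized multinomial logistic fit using the covariates in `S`. -/
def IsRefit {n T p : ℕ} (x : Fin n → Fin p → ℝ) (d : Fin n → Fin (T + 1)) (S : Finset (Fin p))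
    (γ : Fin T → Fin p → ℝ) : Prop :=
  suppUnion γ ⊆ S ∧
    ∀ γ' : Fin T → Fin p → ℝ, suppUnion γ' ⊆ S → mlogitLoss x d γ ≤ mlogitLoss x d γ'

/-- The penalty level
`λ = (2 𝒳 √T / √n) (1 + log(p ∨ n)^(3/2 + δ) / √T)^(1/2)`. -/
def penalty (xbar δ : ℝ) (T n p : ℕ) : ℝ :=
  2 * xbar * Real.sqrt T / Real.sqrt n *
    Real.sqrt (1 + Real.log (max p n : ℕ) ^ (3 / 2 + δ) / Real.sqrt T)

/-! ### Gram matrix, restricted and sparse eigenvalues -/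

/-- The empirical Gram matrix `Q = 𝔼_n[x_i x_i']`. -/
def gram {n p : ℕ} (x : Fin n → Fin p → ℝ) : Matrix (Fin p) (Fin p) ℝ :=
  fun j k => empMean fun i => x i j * x i k

/-- The quadratic form `δ' Q δ`. -/
def quadForm {p : ℕ} (Q : Matrix (Fin p) (Fin p) ℝ) (δ : Fin p → ℝ) : ℝ :=
  ∑ j, ∑ k, δ j * Q j k * δ k

/-- `κ² ≤ min (∑_t δ_t' Q δ_t) / ‖δ_{·,S}‖₂²` over nonzero `δ` in the cone
`|||δ_{·,Sᶜ}||| ≤ 4 |||δ_{·,S}|||` (on which `δ_{·,S} ≠ 0`). -/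
def IsRestrictedEigenvalue {p : ℕ} (T : ℕ) (Q : Matrix (Fin p) (Fin p) ℝ) (S : Finset (Fin p))
    (κ : ℝ) : Prop :=
  ∀ δ : Fin T → Fin p → ℝ, δ ≠ 0 → mixedNormOn Sᶜ δ ≤ 4 * mixedNormOn S δ →
    κ ^ 2 ≤ (∑ t, quadForm Q (δ t)) / ∑ t, ∑ j ∈ S, δ t j ^ 2

/-- The Rayleigh quotients `δ' Q δ / ‖δ‖₂²` of nonzero vectors supported in `S`. -/
def rayleighSet {p : ℕ} (Q : Matrix (Fin p) (Fin p) ℝ) (S : Finset (Fin p)) : Set ℝ :=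
  {r | ∃ δ : Fin p → ℝ, δ ≠ 0 ∧ (∀ j, j ∉ S → δ j = 0) ∧ r = quadForm Q δ / ∑ j, δ j ^ 2}

/-- Minimal sparse eigenvalue `φ{Q, S}` (its square is the minimal Rayleigh quotient);
meaningful for nonempty `S`. -/
def sparseEigMin {p : ℕ} (Q : Matrix (Fin p) (Fin p) ℝ) (S : Finset (Fin p)) : ℝ :=
  Real.sqrt (sInf (rayleighSet Q S))

/-- Maximal sparse eigenvalue over the support set `S` (its square is the maximal quotient). -/
def sparseEigMax {p : ℕ} (Q : Matrix (Fin p) (Fin p) ℝ) (S : Finset (Fin p)) : ℝ :=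
  Real.sqrt (sSup (rayleighSet Q S))

/-- The maximum of `sparseEigMax Q S` over all `S` with at most `m` elements. -/
def sparseEigMaxCard {p : ℕ} (Q : Matrix (Fin p) (Fin p) ℝ) (m : ℕ) : ℝ :=
  sSup {r | ∃ S : Finset (Fin p), S.card ≤ m ∧ r = sparseEigMax Q S}

/-- `R = (A_p / p_min)^(T+1) T A_K (6 λ √s / κ + 8 b √T)` with
`A_p = p_min / (0 ∨ (p_min - b))`. -/
def errorBound (T : ℕ) (pmin AK κ lam b : ℝ) (s : ℕ) : ℝ :=
  (pmin / max 0 (pmin - b) / pmin) ^ (T + 1) * T * AK *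
    (6 * (lam * Real.sqrt s / κ) + 8 * b * Real.sqrt T)

/-- `L = T ((R + b) / (λ √s))²`. -/
def sparsityFactor (T : ℕ) (pmin AK κ lam b : ℝ) (s : ℕ) : ℝ :=
  T * ((errorBound T pmin AK κ lam b s + b) / (lam * Real.sqrt s)) ^ 2

/-- The index set `{m ∈ {1, …, n} : m > 8 s L φ(Q, m)}`, `φ` the maximal `m`-sparse
eigenvalue. -/
def sparsityIndexSet {p : ℕ} (n T : ℕ) (Q : Matrix (Fin p) (Fin p) ℝ) (pmin AK κ lam b : ℝ)
    (s : ℕ) : Set ℕ :=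
  {m | 1 ≤ m ∧ m ≤ n ∧
    8 * s * sparsityFactor T pmin AK κ lam b s * sparseEigMaxCard Q m < (m : ℝ)}

/-- The empirical mean square error `𝔼_n[(p̂_t(x_i*'γ) - p_t(x_i))²]`, where `z i = (x_i, d_i)`
is the sample and `x_i* = R x_i`. -/
def propensityMSE {𝓧 : Type*} [MeasurableSpace 𝓧] {n T p : ℕ} (P : Measure (𝓧 × Fin (T + 1)))
    [IsFiniteMeasure P] (R : 𝓧 → Fin p → ℝ) (z : Fin n → 𝓧 × Fin (T + 1))
    (γ : Fin T → Fin p → ℝ) (t : Fin T) : ℝ :=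
  empMean fun i => (mlogit (logOdds γ (R (z i).1)) t - propensity P t.succ (z i).1) ^ 2

end

end GroupLassoMLogit

/-!
The Bregman divergence of the log-partition function dominates a variance under the fitted law,
divided by one plus the size of the perturbation. Where the fitted probabilities at `γ*` inherit
overlap from the true ones, and up to a bias term where they do not, this makes the loss strongly
convex near `γ*` in the prediction norm, so any two estimates whose coefficient error is at most
a multiple of their prediction error are comparable to `γ*` there.

By Hoeffding's inequality, every column of the score is at most `λ / 8` with probability
approaching one. On that event the group lasso error either lies in the restricted eigenvalue cone
or is controlled by the bias, which gives prediction error `O(λ √s + b)`. Each selected column of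
the gradient has norm exactly `λ`, while the gradient differs from the score by a projection of
the prediction error; hence the number of selected covariates is at most a sparse eigenvalue times
the squared prediction error over `λ²`. Since the maximal sparse eigenvalue of order `n` is
`O(√n)` and `s = o(√n)`, the index `m = n` belongs to the index set of the eigenvalue condition.

The refit has a loss no larger than the group lasso and a sparse error, for which the minimal
sparse eigenvalue bounds the `ℓ₁` norm by `√s` times the prediction norm. The same strong convexity
argument then gives both rates.
-/

namespace GroupLassoMLogit

/-! ### The log-partition function -/

section LogPartition

variable {ι : Type*} [Fintype ι] {p h : ι → ℝ}

theorem sum_mul_exp_pos (hp : p ∈ stdSimplex ℝ ι) (h : ι → ℝ) :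
    0 < ∑ i, p i * Real.exp (h i) := by
  obtain ⟨i, hi, hpi⟩ := Finset.exists_ne_zero_of_sum_ne_zero (hp.2.trans_ne one_ne_zero)
  exact Finset.sum_pos' (fun i _ => mul_nonneg (hp.1 i) (Real.exp_pos _).le)
    ⟨i, hi, mul_pos ((hp.1 i).lt_of_ne' hpi) (Real.exp_pos _)⟩

theorem sum_mul_le_log_sum_mul_exp (hp : p ∈ stdSimplex ℝ ι) (h : ι → ℝ) :
    ∑ i, p i * h i ≤ Real.log (∑ i, p i * Real.exp (h i)) := by
  rw [Real.le_log_iff_exp_le (sum_mul_exp_pos hp h)]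
  exact convexOn_exp.map_sum_le (fun i _ => hp.1 i) hp.2 fun i _ => Set.mem_univ (h i)

theorem log_sum_mul_exp_sub (hp : p ∈ stdSimplex ℝ ι) (h : ι → ℝ) (m : ℝ) :
    Real.log (∑ i, p i * Real.exp (h i - m)) = Real.log (∑ i, p i * Real.exp (h i)) - m := by
  simp only [Real.exp_sub, ← mul_div_assoc, ← Finset.sum_div]
  rw [Real.log_div (sum_mul_exp_pos hp h).ne' (Real.exp_ne_zero m), Real.log_exp]

theorem sum_mul_sq_sub_mean (hp : ∑ i, p i = 1) (h : ι → ℝ) :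
    ∑ i, p i * (h i - ∑ k, p k * h k) ^ 2
      = ∑ i, p i * h i ^ 2 - (∑ i, p i * h i) ^ 2 := by
  set m := ∑ k, p k * h k with hm
  calc ∑ i, p i * (h i - m) ^ 2
      = ∑ i, (p i * h i ^ 2 - 2 * m * (p i * h i) + m ^ 2 * p i) :=
        Finset.sum_congr rfl fun i _ => by ring
    _ = ∑ i, p i * h i ^ 2 - m ^ 2 := by
        rw [Finset.sum_add_distrib, Finset.sum_sub_distrib, ← Finset.mul_sum, ← Finset.mul_sum,
          hp, ← hm]
        ring

theorem one_add_add_sq_div_four_le_exp {g : ℝ} (hg : -2 ≤ g) :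
    1 + g + g ^ 2 / 4 ≤ Real.exp g :=
  calc 1 + g + g ^ 2 / 4 = (1 + g / 2) ^ 2 := by ring
    _ ≤ Real.exp (g / 2) ^ 2 :=
        pow_le_pow_left₀ (by linarith) (by linarith [Real.add_one_le_exp (g / 2)]) 2
    _ = Real.exp g := by rw [← Real.exp_nat_mul]; congr 1; push_cast; ring

theorem one_add_variance_div_four_le (hp : p ∈ stdSimplex ℝ ι) (hh : ∀ i, |h i| ≤ 1) :
    1 + (∑ i, p i * h i ^ 2 - (∑ i, p i * h i) ^ 2) / 4
      ≤ ∑ i, p i * Real.exp (h i - ∑ k, p k * h k) := by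
  rw [← sum_mul_sq_sub_mean hp.2]
  set m := ∑ k, p k * h k with hm
  have hm_le : m ≤ 1 :=
    calc m ≤ ∑ i, p i := Finset.sum_le_sum fun i _ =>
          mul_le_of_le_one_right (hp.1 i) (abs_le.mp (hh i)).2
      _ = 1 := hp.2
  calc 1 + (∑ i, p i * (h i - m) ^ 2) / 4
      = ∑ i, p i * (1 + (h i - m) + (h i - m) ^ 2 / 4) := by
        simp only [mul_add, mul_sub, mul_one, Finset.sum_add_distrib, Finset.sum_sub_distrib,
          ← Finset.sum_mul, hp.2, ← hm, ← mul_div_assoc, ← Finset.sum_div]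
        ring
    _ ≤ _ := Finset.sum_le_sum fun i _ => mul_le_mul_of_nonneg_left
        (one_add_add_sq_div_four_le_exp (by linarith [(abs_le.mp (hh i)).1])) (hp.1 i)

theorem variance_div_eight_le (hp : p ∈ stdSimplex ℝ ι) (hh : ∀ i, |h i| ≤ 1) :
    (∑ i, p i * h i ^ 2 - (∑ i, p i * h i) ^ 2) / 8
      ≤ Real.log (∑ i, p i * Real.exp (h i)) - ∑ i, p i * h i := by
  have hexp := one_add_variance_div_four_le hp hh
  rw [← log_sum_mul_exp_sub hp]
  set V := ∑ i, p i * h i ^ 2 - (∑ i, p i * h i) ^ 2 with hV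
  have hV_nonneg : 0 ≤ V := by
    rw [hV, ← sum_mul_sq_sub_mean hp.2]
    exact Finset.sum_nonneg fun i _ => mul_nonneg (hp.1 i) (sq_nonneg _)
  have hV_le : V ≤ 1 := by
    have hsecond : ∑ i, p i * h i ^ 2 ≤ ∑ i, p i := Finset.sum_le_sum fun i _ =>
      mul_le_of_le_one_right (hp.1 i) ((sq_le_one_iff_abs_le_one _).mpr (hh i))
    linarith [hp.2, sq_nonneg (∑ i, p i * h i)]
  calc V / 8 ≤ 1 - (1 + V / 4)⁻¹ := by
        rw [le_sub_comm, inv_le_iff_one_le_mul₀ (by positivity)]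
        nlinarith
    _ ≤ Real.log (1 + V / 4) := Real.one_sub_inv_le_log_of_pos (by positivity)
    _ ≤ _ := Real.log_le_log (by positivity) hexp

-- Convexity of `r ↦ r ^ c`, applied to `r = exp (h i / c)`.
theorem log_sum_mul_exp_div_le (hp : p ∈ stdSimplex ℝ ι) (h : ι → ℝ) {c : ℝ} (hc : 1 ≤ c) :
    Real.log (∑ i, p i * Real.exp (h i / c)) ≤ Real.log (∑ i, p i * Real.exp (h i)) / c := by
  have hmean := Real.arith_mean_le_rpow_mean Finset.univ p (fun i => Real.exp (h i / c))
    (fun i _ => hp.1 i) hp.2 (fun i _ => (Real.exp_pos _).le) hc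
  simp only [← Real.exp_mul, div_mul_cancel₀ _ (zero_lt_one.trans_le hc).ne'] at hmean
  refine (Real.log_le_log (sum_mul_exp_pos hp _) hmean).trans_eq ?_
  rw [Real.log_rpow (sum_mul_exp_pos hp h), one_div_mul_eq_div]

theorem variance_div_le (hp : p ∈ stdSimplex ℝ ι) {B : ℝ} (hB : 0 ≤ B)
    (hh : ∀ i, |h i| ≤ B) :
    (∑ i, p i * h i ^ 2 - (∑ i, p i * h i) ^ 2) / (8 * (1 + B))
      ≤ Real.log (∑ i, p i * Real.exp (h i)) - ∑ i, p i * h i := by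
  have hc : 0 < 1 + B := by linarith
  have hscaled := variance_div_eight_le (h := fun i => h i / (1 + B)) hp fun i => by
    rw [abs_div, abs_of_pos hc, div_le_one hc]
    linarith [hh i]
  simp only [div_pow, ← mul_div_assoc, ← Finset.sum_div] at hscaled
  have hlog := log_sum_mul_exp_div_le hp h (c := 1 + B) (by linarith)
  calc _ = ((∑ i, p i * h i ^ 2) / (1 + B) ^ 2 - (∑ i, p i * h i) ^ 2 / (1 + B) ^ 2) / 8
          * (1 + B) := by field_simp
    _ ≤ (Real.log (∑ i, p i * Real.exp (h i)) / (1 + B) - (∑ i, p i * h i) / (1 + B))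
          * (1 + B) := mul_le_mul_of_nonneg_right (by linarith) hc.le
    _ = _ := by field_simp

end LogPartition

/-! ### Multinomial logit probabilities -/

section MLogit

variable {T : ℕ}

theorem one_add_sum_exp_pos (w : Fin T → ℝ) : 0 < 1 + ∑ u, Real.exp (w u) := by positivity

theorem mlogit_pos (w : Fin T → ℝ) (t : Fin T) : 0 < mlogit w t :=
  div_pos (Real.exp_pos _) (one_add_sum_exp_pos w)

theorem one_sub_sum_mlogit (w : Fin T → ℝ) :
    1 - ∑ t, mlogit w t = (1 + ∑ u, Real.exp (w u))⁻¹ := by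
  have := one_add_sum_exp_pos w
  simp only [mlogit, ← Finset.sum_div]
  field_simp
  ring

theorem one_sub_sum_mlogit_pos (w : Fin T → ℝ) : 0 < 1 - ∑ t, mlogit w t := by
  rw [one_sub_sum_mlogit]
  exact inv_pos.mpr (one_add_sum_exp_pos w)

theorem mlogit_le_one (w : Fin T → ℝ) (t : Fin T) : mlogit w t ≤ 1 := by
  have hle := Finset.single_le_sum (fun u _ => (mlogit_pos w u).le) (Finset.mem_univ t)
  linarith [one_sub_sum_mlogit_pos w]

theorem sq_sum_mlogit_mul_le (w h : Fin T → ℝ) :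
    (∑ t, mlogit w t * h t) ^ 2 ≤ (∑ t, mlogit w t) * ∑ t, mlogit w t * h t ^ 2 :=
  Finset.sum_sq_le_sum_mul_sum_of_sq_le_mul _ (fun t _ => (mlogit_pos w t).le)
    (fun t _ => mul_nonneg (mlogit_pos w t).le (sq_nonneg _)) fun t _ => le_of_eq (by ring)

/-- The Bregman divergence between `w + h` and `w` of the log-partition function
`w ↦ log (1 + ∑ t, exp (w t))`, whose gradient is `mlogit`. -/
noncomputable def logitBregman (w h : Fin T → ℝ) : ℝ :=
  Real.log (1 + ∑ t, Real.exp (w t + h t)) - Real.log (1 + ∑ t, Real.exp (w t))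
    - ∑ t, mlogit w t * h t

/-- The fitted law on all `T + 1` treatments, the baseline being `none`. -/
noncomputable def fullProb (w : Fin T → ℝ) : Option (Fin T) → ℝ
  | none => 1 - ∑ t, mlogit w t
  | some t => mlogit w t

theorem fullProb_mem_stdSimplex (w : Fin T → ℝ) :
    fullProb w ∈ stdSimplex ℝ (Option (Fin T)) := by
  refine ⟨Option.rec (one_sub_sum_mlogit_pos w).le fun t => (mlogit_pos w t).le, ?_⟩
  simp only [Fintype.sum_option, fullProb, sub_add_cancel]

theorem logitBregman_eq (w h : Fin T → ℝ) :
    logitBregman w h = Real.log (∑ o, fullProb w o * Real.exp (o.elim 0 h))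
      - ∑ o, fullProb w o * o.elim 0 h := by
  have hw := one_add_sum_exp_pos w
  have hwh := one_add_sum_exp_pos fun t => w t + h t
  simp only [logitBregman, Fintype.sum_option, fullProb, Option.elim, mul_zero, zero_add,
    Real.exp_zero, mul_one]
  rw [← Real.log_div hwh.ne' hw.ne', one_sub_sum_mlogit, add_div, Finset.sum_div, one_div]
  congr 3
  exact Finset.sum_congr rfl fun t _ => by rw [mlogit, Real.exp_add, mul_div_right_comm]

theorem logitBregman_nonneg (w h : Fin T → ℝ) : 0 ≤ logitBregman w h := by
  rw [logitBregman_eq, sub_nonneg]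
  exact sum_mul_le_log_sum_mul_exp (fullProb_mem_stdSimplex w) _

theorem le_logitBregman {w h : Fin T → ℝ} {a B : ℝ} (ha : 0 ≤ a) (hB : 0 ≤ B)
    (hh : ∀ t, |h t| ≤ B) (hw : ∀ t, a ≤ mlogit w t) (hw0 : a ≤ 1 - ∑ t, mlogit w t) :
    a ^ 2 * (∑ t, h t ^ 2) / (8 * (1 + B)) ≤ logitBregman w h := by
  have hvar := variance_div_le (fullProb_mem_stdSimplex w) (h := fun o => o.elim 0 h) hB
    (Option.rec (by simpa only [Option.elim, abs_zero] using hB) hh)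
  rw [← logitBregman_eq] at hvar
  refine le_trans (div_le_div_of_nonneg_right ?_ (by positivity)) hvar
  simp only [Fintype.sum_option, fullProb, Option.elim, mul_zero, zero_add, ne_eq,
    OfNat.ofNat_ne_zero, not_false_eq_true, zero_pow]
  have hsecond : a * ∑ t, h t ^ 2 ≤ ∑ t, mlogit w t * h t ^ 2 := by
    rw [Finset.mul_sum]
    exact Finset.sum_le_sum fun t _ => mul_le_mul_of_nonneg_right (hw t) (sq_nonneg _)
  have hsq_nonneg : 0 ≤ ∑ t, h t ^ 2 := Finset.sum_nonneg fun t _ => sq_nonneg _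
  nlinarith [sq_sum_mlogit_mul_le w h,
    mul_le_mul hw0 hsecond (by positivity) (ha.trans hw0)]

theorem exp_neg_mul_mlogit_le {w h : Fin T → ℝ} {B : ℝ} (hB : 0 ≤ B) (hh : ∀ t, |h t| ≤ B)
    (t : Fin T) :
    Real.exp (-(2 * B)) * mlogit w t ≤ mlogit (fun u => w u + h u) t := by
  have hden : 1 + ∑ u, Real.exp (w u + h u) ≤ Real.exp B * (1 + ∑ u, Real.exp (w u)) := by
    rw [mul_add, mul_one, Finset.mul_sum]
    refine add_le_add (Real.one_le_exp hB) (Finset.sum_le_sum fun u _ => ?_)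
    rw [← Real.exp_add]
    exact Real.exp_le_exp.mpr (by linarith [(abs_le.mp (hh u)).2])
  have hnum : Real.exp (-B) * Real.exp (w t) ≤ Real.exp (w t + h t) := by
    rw [← Real.exp_add]
    exact Real.exp_le_exp.mpr (by linarith [(abs_le.mp (hh t)).1])
  calc Real.exp (-(2 * B)) * mlogit w t
      = (Real.exp (-B) * Real.exp (w t)) / (Real.exp B * (1 + ∑ u, Real.exp (w u))) := by
        rw [mlogit, show -(2 * B) = -B - B by ring, Real.exp_sub]
        field_simp
    _ ≤ mlogit (fun u => w u + h u) t := div_le_div₀ (Real.exp_pos _).le hnum (by positivity) hden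

theorem mlogit_sub_mlogit_add_le (w : Fin T → ℝ) {h : Fin T → ℝ} {B : ℝ} (hh : ∀ t, |h t| ≤ B)
    (t : Fin T) : mlogit w t - mlogit (fun u => w u + h u) t ≤ 2 * B := by
  have hB : 0 ≤ B := (abs_nonneg _).trans (hh t)
  nlinarith [exp_neg_mul_mlogit_le (w := w) hB hh t, Real.add_one_le_exp (-(2 * B)),
    mlogit_pos w t, mlogit_le_one w t]

theorem abs_mlogit_add_sub_le (w : Fin T → ℝ) {h : Fin T → ℝ} {B : ℝ} (hh : ∀ t, |h t| ≤ B)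
    (t : Fin T) : |mlogit (fun u => w u + h u) t - mlogit w t| ≤ 2 * B := by
  have hback := mlogit_sub_mlogit_add_le (fun u => w u + h u) (h := fun u => -h u)
    (fun u => (abs_neg (h u)).trans_le (hh u)) t
  simp only [add_neg_cancel_right] at hback
  exact abs_le.mpr ⟨by linarith [mlogit_sub_mlogit_add_le w hh t], hback⟩

end MLogit

/-! ### Empirical means -/

section EmpMean

variable {n : ℕ}

theorem empMean_add (f g : Fin n → ℝ) :
    empMean (fun i => f i + g i) = empMean f + empMean g := by
  simp only [empMean, Finset.sum_add_distrib, add_div]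

theorem empMean_sub (f g : Fin n → ℝ) :
    empMean (fun i => f i - g i) = empMean f - empMean g := by
  simp only [empMean, Finset.sum_sub_distrib, sub_div]

theorem empMean_const_mul (c : ℝ) (f : Fin n → ℝ) :
    empMean (fun i => c * f i) = c * empMean f := by
  simp only [empMean, ← Finset.mul_sum, mul_div_assoc]

theorem empMean_mul_const (c : ℝ) (f : Fin n → ℝ) :
    empMean (fun i => f i * c) = empMean f * c := by
  simp only [empMean, ← Finset.sum_mul, div_mul_eq_mul_div]

theorem empMean_sum {ι : Type*} (s : Finset ι) (f : ι → Fin n → ℝ) :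
    empMean (fun i => ∑ k ∈ s, f k i) = ∑ k ∈ s, empMean (f k) := by
  simp only [empMean]
  rw [Finset.sum_comm, Finset.sum_div]

theorem empMean_mono {f g : Fin n → ℝ} (h : ∀ i, f i ≤ g i) : empMean f ≤ empMean g :=
  div_le_div_of_nonneg_right (Finset.sum_le_sum fun i _ => h i) n.cast_nonneg

theorem empMean_nonneg {f : Fin n → ℝ} (h : ∀ i, 0 ≤ f i) : 0 ≤ empMean f :=
  div_nonneg (Finset.sum_nonneg fun i _ => h i) n.cast_nonneg

theorem abs_empMean_mul_le (f g : Fin n → ℝ) :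
    |empMean (fun i => f i * g i)|
      ≤ Real.sqrt (empMean fun i => f i ^ 2) * Real.sqrt (empMean fun i => g i ^ 2) := by
  rw [← Real.sqrt_mul (empMean_nonneg fun i => sq_nonneg _)]
  refine Real.abs_le_sqrt ?_
  simp only [empMean, div_pow, div_mul_div_comm, ← sq]
  exact div_le_div_of_nonneg_right (Finset.sum_mul_sq_le_sq_mul_sq _ _ _) (by positivity)

end EmpMean

/-! ### Norms of coefficient collections -/

section Norms

variable {n T p : ℕ}

theorem sum_sq_nonneg {ι : Type*} [Fintype ι] (f : ι → ℝ) : 0 ≤ ∑ i, f i ^ 2 :=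
  Finset.sum_nonneg fun i _ => sq_nonneg (f i)

theorem abs_le_sqrt_sum_sq {ι : Type*} [Fintype ι] (f : ι → ℝ) (i : ι) :
    |f i| ≤ Real.sqrt (∑ k, f k ^ 2) :=
  Real.abs_le_sqrt (Finset.single_le_sum (fun k _ => sq_nonneg (f k)) (Finset.mem_univ i))

/-- The Euclidean norm `‖δ_{·,j}‖₂` over treatments of the coefficients of covariate `j`. -/
noncomputable def colNorm (δ : Fin T → Fin p → ℝ) (j : Fin p) : ℝ :=
  Real.sqrt (∑ t, δ t j ^ 2)

theorem colNorm_eq_norm (δ : Fin T → Fin p → ℝ) (j : Fin p) :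
    colNorm δ j = ‖(WithLp.toLp 2 fun t => δ t j : EuclideanSpace ℝ (Fin T))‖ := by
  simp only [EuclideanSpace.norm_eq, colNorm, Real.norm_eq_abs, sq_abs]

theorem colNorm_nonneg (δ : Fin T → Fin p → ℝ) (j : Fin p) : 0 ≤ colNorm δ j :=
  Real.sqrt_nonneg _

theorem sq_colNorm (δ : Fin T → Fin p → ℝ) (j : Fin p) : colNorm δ j ^ 2 = ∑ t, δ t j ^ 2 :=
  Real.sq_sqrt (sum_sq_nonneg _)

theorem colNorm_sub_le (γ δ : Fin T → Fin p → ℝ) (j : Fin p) :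
    colNorm (γ - δ) j ≤ colNorm γ j + colNorm δ j := by
  simp only [colNorm_eq_norm]
  exact norm_sub_le (WithLp.toLp 2 fun t => γ t j : EuclideanSpace ℝ (Fin T))
    (WithLp.toLp 2 fun t => δ t j)

theorem abs_le_colNorm (δ : Fin T → Fin p → ℝ) (t : Fin T) (j : Fin p) :
    |δ t j| ≤ colNorm δ j :=
  abs_le_sqrt_sum_sq (fun u => δ u j) t

theorem colNorm_le_sum_abs (δ : Fin T → Fin p → ℝ) (j : Fin p) :
    colNorm δ j ≤ ∑ t, |δ t j| := by
  refine Real.sqrt_le_iff.mpr ⟨Finset.sum_nonneg fun _ _ => abs_nonneg _, ?_⟩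
  calc ∑ t, δ t j ^ 2 = ∑ t, |δ t j| ^ 2 := by simp only [sq_abs]
    _ ≤ _ := Finset.sum_sq_le_sq_sum_of_nonneg fun _ _ => abs_nonneg _

theorem abs_sum_mul_le_colNorm_mul (g δ : Fin T → Fin p → ℝ) (j : Fin p) :
    |∑ t, g t j * δ t j| ≤ colNorm g j * colNorm δ j := by
  rw [colNorm, colNorm, ← Real.sqrt_mul (sum_sq_nonneg _)]
  exact Real.abs_le_sqrt (Finset.sum_mul_sq_le_sq_mul_sq _ _ _)

theorem mixedNormOn_eq (S : Finset (Fin p)) (δ : Fin T → Fin p → ℝ) :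
    mixedNormOn S δ = ∑ j ∈ S, colNorm δ j := rfl

theorem mixedNormOn_nonneg (S : Finset (Fin p)) (δ : Fin T → Fin p → ℝ) :
    0 ≤ mixedNormOn S δ :=
  Finset.sum_nonneg fun _ _ => colNorm_nonneg _ _

theorem mixedNormOn_add_compl (S : Finset (Fin p)) (δ : Fin T → Fin p → ℝ) :
    mixedNormOn S δ + mixedNormOn Sᶜ δ = mixedNormOn Finset.univ δ :=
  Finset.sum_add_sum_compl S _

theorem sum_abs_le_mixedNormOn (δ : Fin T → Fin p → ℝ) (t : Fin T) :
    ∑ j, |δ t j| ≤ mixedNormOn Finset.univ δ :=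
  Finset.sum_le_sum fun j _ => abs_le_colNorm δ t j

theorem abs_sum_mul_le_mul_mixedNormOn {g : Fin T → Fin p → ℝ} {σ : ℝ}
    (hg : ∀ j, colNorm g j ≤ σ) (δ : Fin T → Fin p → ℝ) :
    |∑ t, ∑ j, g t j * δ t j| ≤ σ * mixedNormOn Finset.univ δ := by
  rw [Finset.sum_comm, mixedNormOn_eq, Finset.mul_sum]
  refine (Finset.abs_sum_le_sum_abs _ _).trans (Finset.sum_le_sum fun j _ => ?_)
  exact (abs_sum_mul_le_colNorm_mul g δ j).trans
    (mul_le_mul_of_nonneg_right (hg j) (colNorm_nonneg δ j))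

theorem mem_suppUnion {γ : Fin T → Fin p → ℝ} {j : Fin p} :
    j ∈ suppUnion γ ↔ 0 < colNorm γ j := by
  simp only [suppUnion, colNorm, Finset.mem_filter_univ]

theorem eq_zero_of_notMem_suppUnion {γ : Fin T → Fin p → ℝ} {j : Fin p}
    (h : j ∉ suppUnion γ) (t : Fin T) : γ t j = 0 := by
  rw [mem_suppUnion, not_lt] at h
  exact abs_nonpos_iff.mp ((abs_le_colNorm γ t j).trans h)

theorem logOdds_add (γ δ : Fin T → Fin p → ℝ) (xi : Fin p → ℝ) :
    logOdds (γ + δ) xi = fun t => logOdds γ xi t + logOdds δ xi t := by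
  funext t
  simp only [logOdds, Pi.add_apply, mul_add, Finset.sum_add_distrib]

theorem logOdds_smul (c : ℝ) (δ : Fin T → Fin p → ℝ) (xi : Fin p → ℝ) :
    logOdds (c • δ) xi = c • logOdds δ xi := by
  funext t
  simp only [logOdds, Pi.smul_apply, smul_eq_mul, Finset.mul_sum, mul_left_comm]

theorem sqrt_sum_sq_logOdds_le {xi : Fin p → ℝ} {X : ℝ} (hX : ∀ j, |xi j| ≤ X)
    (δ : Fin T → Fin p → ℝ) :
    Real.sqrt (∑ t, logOdds δ xi t ^ 2) ≤ X * mixedNormOn Finset.univ δ := by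
  let col : Fin p → EuclideanSpace ℝ (Fin T) := fun j => WithLp.toLp 2 fun t => δ t j
  calc Real.sqrt (∑ t, logOdds δ xi t ^ 2) = ‖∑ j, xi j • col j‖ := by
        simp only [EuclideanSpace.norm_eq, logOdds, col, WithLp.ofLp_sum, WithLp.ofLp_smul,
          Finset.sum_apply, Pi.smul_apply, smul_eq_mul, Real.norm_eq_abs, sq_abs]
    _ ≤ ∑ j, ‖xi j • col j‖ := norm_sum_le _ _
    _ ≤ ∑ j, X * colNorm δ j := Finset.sum_le_sum fun j _ => by
        rw [norm_smul, ← colNorm_eq_norm]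
        exact mul_le_mul_of_nonneg_right (hX j) (colNorm_nonneg δ j)
    _ = X * mixedNormOn Finset.univ δ := by rw [mixedNormOn_eq, Finset.mul_sum]

/-- The prediction norm `(∑_t δ_t' Q δ_t)^{1/2}`, with `Q` the Gram matrix of `x`. -/
noncomputable def fitNorm (x : Fin n → Fin p → ℝ) (δ : Fin T → Fin p → ℝ) : ℝ :=
  Real.sqrt (empMean fun i => ∑ t, logOdds δ (x i) t ^ 2)

theorem fitNorm_nonneg (x : Fin n → Fin p → ℝ) (δ : Fin T → Fin p → ℝ) : 0 ≤ fitNorm x δ :=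
  Real.sqrt_nonneg _

theorem sq_fitNorm (x : Fin n → Fin p → ℝ) (δ : Fin T → Fin p → ℝ) :
    fitNorm x δ ^ 2 = empMean fun i => ∑ t, logOdds δ (x i) t ^ 2 :=
  Real.sq_sqrt (empMean_nonneg fun _ => sum_sq_nonneg _)

theorem sqrt_empMean_sq_logOdds_le (x : Fin n → Fin p → ℝ) (δ : Fin T → Fin p → ℝ)
    (t : Fin T) : Real.sqrt (empMean fun i => logOdds δ (x i) t ^ 2) ≤ fitNorm x δ :=
  Real.sqrt_le_sqrt (empMean_mono fun i =>
    Finset.single_le_sum (f := fun t => logOdds δ (x i) t ^ 2) (fun _ _ => sq_nonneg _)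
      (Finset.mem_univ t))

theorem quadForm_gram (x : Fin n → Fin p → ℝ) (v : Fin p → ℝ) :
    quadForm (gram x) v = empMean fun i => (∑ j, x i j * v j) ^ 2 := by
  have hsq : ∀ i, (∑ j, x i j * v j) ^ 2 = ∑ j, ∑ k, v j * (x i j * x i k) * v k := fun i => by
    rw [sq, Finset.sum_mul_sum]
    exact Finset.sum_congr rfl fun j _ => Finset.sum_congr rfl fun k _ => by ring
  simp only [hsq, empMean_sum, empMean_const_mul, empMean_mul_const, quadForm, gram]

theorem quadForm_gram_nonneg (x : Fin n → Fin p → ℝ) (v : Fin p → ℝ) :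
    0 ≤ quadForm (gram x) v := by
  rw [quadForm_gram]
  exact empMean_nonneg fun _ => sq_nonneg _

theorem sum_quadForm_gram (x : Fin n → Fin p → ℝ) (δ : Fin T → Fin p → ℝ) :
    ∑ t, quadForm (gram x) (δ t) = fitNorm x δ ^ 2 := by
  rw [sq_fitNorm, empMean_sum]
  exact Finset.sum_congr rfl fun t _ => quadForm_gram x (δ t)

end Norms

/-! ### The loss and its gradient -/

section Loss

variable {n T p : ℕ}

/-- The gradient of the multinomial logistic loss. -/
noncomputable def lossGrad (x : Fin n → Fin p → ℝ) (d : Fin n → Fin (T + 1))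
    (γ : Fin T → Fin p → ℝ) (t : Fin T) (j : Fin p) : ℝ :=
  empMean fun i => x i j * (mlogit (logOdds γ (x i)) t - if d i = t.succ then 1 else 0)

/-- The score `𝔼_n[x_{ij} (1{d_i = t} - π_{it})]`: minus the gradient of the loss, with `π` in
place of the fitted probabilities. -/
noncomputable def score (x : Fin n → Fin p → ℝ) (d : Fin n → Fin (T + 1))
    (π : Fin n → Fin T → ℝ) (t : Fin T) (j : Fin p) : ℝ :=
  empMean fun i => x i j * ((if d i = t.succ then 1 else 0) - π i t)

/-- The mean square distance `𝔼_n[(p̂_t(x_i'γ) - π_{it})²]` of the fitted probabilities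
from `π`. -/
noncomputable def fitMSE (x : Fin n → Fin p → ℝ) (π : Fin n → Fin T → ℝ)
    (γ : Fin T → Fin p → ℝ) (t : Fin T) : ℝ :=
  empMean fun i => (mlogit (logOdds γ (x i)) t - π i t) ^ 2

theorem lossGrad_eq (x : Fin n → Fin p → ℝ) (d : Fin n → Fin (T + 1))
    (π : Fin n → Fin T → ℝ) (γ : Fin T → Fin p → ℝ) (t : Fin T) (j : Fin p) :
    lossGrad x d γ t j
      = empMean (fun i => x i j * (mlogit (logOdds γ (x i)) t - π i t)) - score x d π t j := by
  rw [lossGrad, score, ← empMean_sub]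
  congr 1
  funext i
  ring

theorem sum_empMean_mul_mul (x : Fin n → Fin p → ℝ) (r : Fin n → Fin T → ℝ)
    (δ : Fin T → Fin p → ℝ) :
    ∑ t, ∑ j, empMean (fun i => x i j * r i t) * δ t j
      = ∑ t, empMean fun i => r i t * logOdds δ (x i) t := by
  simp only [logOdds, Finset.mul_sum, empMean_sum, ← empMean_mul_const]
  refine Finset.sum_congr rfl fun t _ => Finset.sum_congr rfl fun j _ => ?_
  congr 1
  funext i
  ring

theorem mlogitLoss_add (x : Fin n → Fin p → ℝ) (d : Fin n → Fin (T + 1))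
    (γ δ : Fin T → Fin p → ℝ) :
    mlogitLoss x d (γ + δ) = mlogitLoss x d γ + ∑ t, ∑ j, lossGrad x d γ t j * δ t j
      + empMean fun i => logitBregman (logOdds γ (x i)) (logOdds δ (x i)) := by
  simp only [lossGrad]
  rw [sum_empMean_mul_mul x fun i t => mlogit (logOdds γ (x i)) t - if d i = t.succ then 1 else 0,
    ← empMean_sum, mlogitLoss, mlogitLoss, ← empMean_add, ← empMean_add]
  congr 1
  funext i
  have hlin : (∑ t : Fin T, if d i = t.succ then logOdds γ (x i) t + logOdds δ (x i) t else 0)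
      = (∑ t : Fin T, if d i = t.succ then logOdds γ (x i) t else 0)
        + ∑ t : Fin T, if d i = t.succ then logOdds δ (x i) t else 0 := by
    rw [← Finset.sum_add_distrib]
    exact Finset.sum_congr rfl fun t _ => by rw [ite_add_zero]
  simp only [logOdds_add, logitBregman, sub_mul, Finset.sum_sub_distrib, ite_mul, one_mul,
    zero_mul, hlin]
  ring

theorem fitMSE_add_le (x : Fin n → Fin p → ℝ) (π : Fin n → Fin T → ℝ)
    (γ δ : Fin T → Fin p → ℝ) (t : Fin T) :
    fitMSE x π (γ + δ) t ≤ 2 * fitMSE x π γ t + 8 * fitNorm x δ ^ 2 := by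
  rw [fitMSE, fitMSE, sq_fitNorm, ← empMean_const_mul, ← empMean_const_mul, ← empMean_add]
  refine empMean_mono fun i => ?_
  set r := mlogit (logOdds γ (x i)) t - π i t
  set Δ := mlogit (logOdds (γ + δ) (x i)) t - mlogit (logOdds γ (x i)) t with hΔ
  have hΔ_le : |Δ| ≤ 2 * Real.sqrt (∑ u, logOdds δ (x i) u ^ 2) := by
    rw [hΔ, logOdds_add]
    exact abs_mlogit_add_sub_le _ (abs_le_sqrt_sum_sq _) t
  have hΔ_sq : Δ ^ 2 ≤ 4 * ∑ u, logOdds δ (x i) u ^ 2 := by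
    rw [← sq_abs]
    refine (pow_le_pow_left₀ (abs_nonneg _) hΔ_le 2).trans_eq ?_
    rw [mul_pow, Real.sq_sqrt (sum_sq_nonneg _)]
    norm_num
  calc (mlogit (logOdds (γ + δ) (x i)) t - π i t) ^ 2 = (r + Δ) ^ 2 := by ring
    _ ≤ 2 * r ^ 2 + 8 * ∑ u, logOdds δ (x i) u ^ 2 := by nlinarith [sq_nonneg (r - Δ)]

end Loss

/-! ### Restricted strong convexity -/

section StrongConvexity

variable {n T p : ℕ}

/-- The sample conditions under which the finite-sample bounds around `γ` hold: covariates
bounded by `X`, overlap of the propensity scores `π`, all columns of the score of dual norm at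
most `σ`, and approximation error of `γ` at most `b`. The baseline propensity score
is `1 - ∑ t, π i t`. -/
structure RegularSample (X pmin σ b : ℝ) (x : Fin n → Fin p → ℝ) (d : Fin n → Fin (T + 1))
    (π : Fin n → Fin T → ℝ) (γ : Fin T → Fin p → ℝ) : Prop where
  bound_nonneg : 0 ≤ X
  overlap_pos : 0 < pmin
  bounded : ∀ i j, |x i j| ≤ X
  overlap : ∀ i t, pmin ≤ π i t
  overlap_baseline : ∀ i, pmin ≤ 1 - ∑ t, π i t
  score_le : ∀ j, colNorm (score x d π) j ≤ σ
  bias_nonneg : 0 ≤ b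
  bias_le : ∀ t, fitMSE x π γ t ≤ b ^ 2

theorem half_le_mlogit {w π : Fin T → ℝ} {a : ℝ} (hπ : ∀ t, a ≤ π t)
    (hdist : ∑ t, |mlogit w t - π t| ≤ a / 2) (t : Fin T) : a / 2 ≤ mlogit w t := by
  have hdist_t : |mlogit w t - π t| ≤ a / 2 :=
    (Finset.single_le_sum (f := fun t => |mlogit w t - π t|) (fun _ _ => abs_nonneg _)
      (Finset.mem_univ t)).trans hdist
  linarith [hπ t, neg_le_of_abs_le hdist_t]

theorem half_le_one_sub_sum_mlogit {w π : Fin T → ℝ} {a : ℝ} (hπ0 : a ≤ 1 - ∑ t, π t)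
    (hdist : ∑ t, |mlogit w t - π t| ≤ a / 2) : a / 2 ≤ 1 - ∑ t, mlogit w t := by
  have hsum : ∑ t, (mlogit w t - π t) ≤ a / 2 :=
    (Finset.sum_le_sum fun t _ => le_abs_self _).trans hdist
  rw [Finset.sum_sub_distrib] at hsum
  linarith

-- Where the fitted probabilities are close to `π` they inherit its overlap; elsewhere the left
-- side is nonpositive.
theorem le_logitBregman_of_overlap {w h π : Fin T → ℝ} {a B : ℝ} (ha : 0 < a)
    (hπ : ∀ t, a ≤ π t) (hπ0 : a ≤ 1 - ∑ t, π t) (hh : Real.sqrt (∑ t, h t ^ 2) ≤ B) :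
    (a / 2) ^ 2 / (8 * (1 + B)) *
        (∑ t, h t ^ 2 - B ^ 2 * (4 * T / a ^ 2 * ∑ t, (mlogit w t - π t) ^ 2))
      ≤ logitBregman w h := by
  have hB : 0 ≤ B := (Real.sqrt_nonneg _).trans hh
  have hcoef : 0 ≤ (a / 2) ^ 2 / (8 * (1 + B)) := by positivity
  rcases le_or_gt (∑ t, |mlogit w t - π t|) (a / 2) with hclose | hfar
  · refine le_trans ?_ (le_logitBregman (by positivity) hB
      (fun t => (abs_le_sqrt_sum_sq h t).trans hh) (half_le_mlogit hπ hclose)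
      (half_le_one_sub_sum_mlogit hπ0 hclose))
    rw [mul_div_right_comm ((a / 2) ^ 2)]
    exact mul_le_mul_of_nonneg_left (sub_le_self _ (by positivity)) hcoef
  · refine le_trans ?_ (logitBregman_nonneg w h)
    refine mul_nonpos_of_nonneg_of_nonpos hcoef (sub_nonpos.mpr ?_)
    refine ((Real.sqrt_le_left hB).mp hh).trans (le_mul_of_one_le_right (by positivity) ?_)
    have hcs : (∑ t, |mlogit w t - π t|) ^ 2 ≤ T * ∑ t, (mlogit w t - π t) ^ 2 := by
      simpa only [Finset.card_univ, Fintype.card_fin, sq_abs] using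
        sq_sum_le_card_mul_sum_sq (s := Finset.univ) (f := fun t => |mlogit w t - π t|)
    have hfar_sq := pow_le_pow_left₀ (by positivity) hfar.le 2
    rw [div_mul_eq_mul_div, one_le_div (by positivity)]
    linarith

variable {X pmin σ b : ℝ} {x : Fin n → Fin p → ℝ} {d : Fin n → Fin (T + 1)}
  {π : Fin n → Fin T → ℝ} {γ δ : Fin T → Fin p → ℝ}

theorem RegularSample.sum_fitMSE_le (hreg : RegularSample X pmin σ b x d π γ) :
    ∑ t, fitMSE x π γ t ≤ T * b ^ 2 :=
  calc ∑ t, fitMSE x π γ t ≤ ∑ _t : Fin T, b ^ 2 := Finset.sum_le_sum fun t _ => hreg.bias_le t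
    _ = T * b ^ 2 := by simp only [Finset.sum_const, Finset.card_fin, nsmul_eq_mul]

theorem RegularSample.le_empMean_logitBregman (hreg : RegularSample X pmin σ b x d π γ) {B : ℝ}
    (hB : X * mixedNormOn Finset.univ δ ≤ B) :
    (pmin / 2) ^ 2 / (8 * (1 + B)) * (fitNorm x δ ^ 2 - B ^ 2 * (4 * T / pmin ^ 2 * (T * b ^ 2)))
      ≤ empMean fun i => logitBregman (logOdds γ (x i)) (logOdds δ (x i)) := by
  have hmean := empMean_mono fun i => le_logitBregman_of_overlap (w := logOdds γ (x i))
    hreg.overlap_pos (hreg.overlap i) (hreg.overlap_baseline i)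
    ((sqrt_sum_sq_logOdds_le (hreg.bounded i) δ).trans hB)
  simp only [empMean_const_mul, empMean_sub] at hmean
  rw [← sq_fitNorm, empMean_sum] at hmean
  have hB_nonneg : 0 ≤ B :=
    (mul_nonneg hreg.bound_nonneg (mixedNormOn_nonneg _ δ)).trans hB
  have hmse := hreg.sum_fitMSE_le
  refine le_trans ?_ hmean
  simp only [fitMSE] at hmse
  gcongr

theorem RegularSample.sq_fitNorm_le (hreg : RegularSample X pmin σ b x d π γ) {N : ℝ}
    (hN : mixedNormOn Finset.univ δ ≤ N * fitNorm x δ)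
    (hbias : 8 * (T * (X * N * b)) ^ 2 ≤ pmin ^ 2) :
    pmin ^ 2 / 64 * fitNorm x δ ^ 2 ≤ (1 + X * N * fitNorm x δ)
      * empMean fun i => logitBregman (logOdds γ (x i)) (logOdds δ (x i)) := by
  have hpmin := hreg.overlap_pos
  set q := fitNorm x δ
  set B := X * N * q with hB
  have hXN : X * mixedNormOn Finset.univ δ ≤ B := by
    rw [hB, mul_assoc]
    exact mul_le_mul_of_nonneg_left hN hreg.bound_nonneg
  have hB_nonneg : 0 ≤ B :=
    (mul_nonneg hreg.bound_nonneg (mixedNormOn_nonneg _ δ)).trans hXN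
  have hbias_le : B ^ 2 * (4 * T / pmin ^ 2 * (T * b ^ 2)) ≤ q ^ 2 / 2 :=
    calc _ = 8 * (T * (X * N * b)) ^ 2 / pmin ^ 2 * (q ^ 2 / 2) := by field_simp; ring
      _ ≤ 1 * (q ^ 2 / 2) := by
          gcongr
          exact div_le_one_of_le₀ hbias (by positivity)
      _ = q ^ 2 / 2 := one_mul _
  calc pmin ^ 2 / 64 * q ^ 2 = (1 + B) * ((pmin / 2) ^ 2 / (8 * (1 + B)) * (q ^ 2 / 2)) := by
        field_simp; ring
    _ ≤ (1 + B) * ((pmin / 2) ^ 2 / (8 * (1 + B))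
          * (q ^ 2 - B ^ 2 * (4 * T / pmin ^ 2 * (T * b ^ 2)))) := by
        gcongr
        linarith
    _ ≤ _ := mul_le_mul_of_nonneg_left (hreg.le_empMean_logitBregman hXN) (by positivity)

theorem RegularSample.neg_sum_lossGrad_mul_le (hreg : RegularSample X pmin σ b x d π γ)
    (δ : Fin T → Fin p → ℝ) :
    -∑ t, ∑ j, lossGrad x d γ t j * δ t j
      ≤ σ * mixedNormOn Finset.univ δ + T * b * fitNorm x δ := by
  set bias : Fin T → ℝ := fun t =>
    empMean fun i => (mlogit (logOdds γ (x i)) t - π i t) * logOdds δ (x i) t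
  have hsplit : ∑ t, ∑ j, lossGrad x d γ t j * δ t j
      = ∑ t, bias t - ∑ t, ∑ j, score x d π t j * δ t j := by
    simp only [lossGrad_eq x d π, sub_mul, Finset.sum_sub_distrib]
    rw [sum_empMean_mul_mul x fun i t => mlogit (logOdds γ (x i)) t - π i t]
  have hbias : ∀ t, |bias t| ≤ b * fitNorm x δ := fun t =>
    (abs_empMean_mul_le _ _).trans (mul_le_mul
      (Real.sqrt_le_iff.mpr ⟨hreg.bias_nonneg, hreg.bias_le t⟩)
      (sqrt_empMean_sq_logOdds_le x δ t) (Real.sqrt_nonneg _) hreg.bias_nonneg)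
  have hsum_bias : -∑ t, bias t ≤ T * b * fitNorm x δ :=
    calc -∑ t, bias t = ∑ t, -bias t := Finset.sum_neg_distrib _ |>.symm
      _ ≤ ∑ _t : Fin T, b * fitNorm x δ :=
          Finset.sum_le_sum fun t _ => (neg_le_abs _).trans (hbias t)
      _ = T * b * fitNorm x δ := by
          rw [Finset.sum_const, Finset.card_fin, nsmul_eq_mul, mul_assoc]
  linarith [le_of_abs_le (abs_sum_mul_le_mul_mixedNormOn hreg.score_le δ)]

theorem RegularSample.empMean_logitBregman_le (hreg : RegularSample X pmin σ b x d π γ)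
    {U : ℝ} (hU : mlogitLoss x d (γ + δ) ≤ mlogitLoss x d γ + U) :
    empMean (fun i => logitBregman (logOdds γ (x i)) (logOdds δ (x i)))
      ≤ U + σ * mixedNormOn Finset.univ δ + T * b * fitNorm x δ := by
  rw [mlogitLoss_add] at hU
  linarith [hreg.neg_sum_lossGrad_mul_le δ]

theorem le_mul_of_sq_le {c K M e q : ℝ} (hc : 0 < c) (hK : 0 ≤ K) (he : 0 ≤ e)
    (hM : M * e ≤ 1) (hMK : M * e * K ≤ c / 2)
    (h : c * q ^ 2 ≤ (1 + M * q) * (K * e * (e + q))) :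
    q ≤ (1 + 6 * K / c) * e := by
  rcases le_or_gt q e with hqe | hqe
  · nlinarith [show 0 ≤ 6 * K / c * e by positivity]
  have hq : 0 < q := he.trans_lt hqe
  have hlinear : M * e * (K * e * q) ≤ 1 * (K * e * q) := by gcongr
  have hquadratic : M * e * K * q ^ 2 ≤ c / 2 * q ^ 2 := by gcongr
  have hconst : K * e * e ≤ K * e * q := by gcongr
  have hmain : c * q ≤ 6 * K * e := le_of_mul_le_mul_right (by nlinarith) hq
  have hq_le : q ≤ 6 * K / c * e := by
    rwa [div_mul_eq_mul_div, le_div_iff₀' hc]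
  linarith

/-- The radius below which restricted strong convexity of the loss dominates its
non-quadratic part. -/
noncomputable def localRadius (T : ℕ) (pmin K : ℝ) : ℝ :=
  (1 + 3 * T / pmin + 128 * K / pmin ^ 2)⁻¹

/-- The constant in the localized estimation error bound. -/
noncomputable def errorConst (pmin K : ℝ) : ℝ := 1 + 384 * K / pmin ^ 2

theorem localRadius_pos {pmin K : ℝ} (T : ℕ) (hpmin : 0 < pmin) (hK : 0 ≤ K) :
    0 < localRadius T pmin K := by
  rw [localRadius]
  positivity

theorem localRadius_bounds {pmin K : ℝ} (T : ℕ) (hpmin : 0 < pmin) (hK : 0 ≤ K) :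
    localRadius T pmin K ≤ 1 ∧ T * localRadius T pmin K ≤ pmin / 3
      ∧ localRadius T pmin K * K ≤ pmin ^ 2 / 128 := by
  have hden : 0 < 1 + 3 * T / pmin + 128 * K / pmin ^ 2 := by positivity
  have hT : 0 ≤ 3 * (T : ℝ) / pmin := by positivity
  have hK' : 0 ≤ 128 * K / pmin ^ 2 := by positivity
  rw [localRadius, ← div_eq_mul_inv, inv_mul_eq_div]
  refine ⟨inv_le_one_of_one_le₀ (by linarith), ?_, ?_⟩
  · rw [div_le_iff₀ hden]
    calc (T : ℝ) = pmin / 3 * (3 * T / pmin) := by field_simp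
      _ ≤ _ := by gcongr; linarith
  · rw [div_le_iff₀ hden]
    calc K = pmin ^ 2 / 128 * (128 * K / pmin ^ 2) := by field_simp
      _ ≤ _ := by gcongr; linarith

theorem RegularSample.fitNorm_le (hreg : RegularSample X pmin σ b x d π γ) {N U K e : ℝ}
    (hK : 0 ≤ K) (hN_nonneg : 0 ≤ N) (hbe : b ≤ e)
    (hN : mixedNormOn Finset.univ δ ≤ N * fitNorm x δ)
    (hU : mlogitLoss x d (γ + δ) ≤ mlogitLoss x d γ + U)
    (hbound : U + σ * mixedNormOn Finset.univ δ + T * b * fitNorm x δ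
      ≤ K * e * (e + fitNorm x δ))
    (hloc : X * N * e ≤ localRadius T pmin K) :
    fitNorm x δ ≤ errorConst pmin K * e := by
  have hpmin := hreg.overlap_pos
  have hX := hreg.bound_nonneg
  have hb := hreg.bias_nonneg
  have hq := fitNorm_nonneg x δ
  obtain ⟨hρ_one, hρ_T, hρ_K⟩ := localRadius_bounds T hpmin hK
  have hbias : T * (X * N * b) ≤ pmin / 3 :=
    calc T * (X * N * b) ≤ T * (X * N * e) := by gcongr
      _ ≤ T * localRadius T pmin K := by gcongr
      _ ≤ pmin / 3 := hρ_T
  have hconvex := hreg.sq_fitNorm_le hN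
    (by nlinarith [pow_le_pow_left₀ (by positivity) hbias 2])
  have hq_le := le_mul_of_sq_le (show 0 < pmin ^ 2 / 64 by positivity) hK (hb.trans hbe)
    (hloc.trans hρ_one) (by linarith [mul_le_mul_of_nonneg_right hloc hK])
    (hconvex.trans (mul_le_mul_of_nonneg_left
      ((hreg.empMean_logitBregman_le hU).trans hbound) (by positivity)))
  refine hq_le.trans_eq ?_
  rw [errorConst]
  field_simp
  ring

end StrongConvexity

/-! ### Sparse and restricted eigenvalues -/

section SparseEig

variable {n T p : ℕ} {x : Fin n → Fin p → ℝ} {X c : ℝ} {S : Finset (Fin p)}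

theorem sum_sq_pos {ι : Type*} [Fintype ι] {v : ι → ℝ} (hv : v ≠ 0) : 0 < ∑ j, v j ^ 2 := by
  obtain ⟨j, hj⟩ := Function.ne_iff.mp hv
  exact Finset.sum_pos' (fun _ _ => sq_nonneg _) ⟨j, Finset.mem_univ j, sq_pos_of_ne_zero hj⟩

theorem quadForm_zero (Q : Matrix (Fin p) (Fin p) ℝ) : quadForm Q 0 = 0 := by
  simp only [quadForm, Pi.zero_apply, mul_zero, Finset.sum_const_zero]

theorem sq_sum_mul_le_of_support {xi v : Fin p → ℝ} (hX : ∀ j, |xi j| ≤ X)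
    (hv : ∀ j, j ∉ S → v j = 0) :
    (∑ j, xi j * v j) ^ 2 ≤ X ^ 2 * S.card * ∑ j, v j ^ 2 :=
  calc (∑ j, xi j * v j) ^ 2 = (∑ j ∈ S, xi j * v j) ^ 2 := by
        rw [Finset.sum_subset (Finset.subset_univ S) fun j _ hj => by rw [hv j hj, mul_zero]]
    _ ≤ (∑ j ∈ S, xi j ^ 2) * ∑ j ∈ S, v j ^ 2 := Finset.sum_mul_sq_le_sq_mul_sq _ _ _
    _ ≤ (∑ _j ∈ S, X ^ 2) * ∑ j, v j ^ 2 := by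
        gcongr ?_ * ?_
        · exact Finset.sum_le_sum fun j _ =>
            sq_le_sq' (neg_le_of_abs_le (hX j)) (le_of_abs_le (hX j))
        · exact Finset.sum_le_sum_of_subset_of_nonneg (Finset.subset_univ S)
            fun j _ _ => sq_nonneg (v j)
    _ = X ^ 2 * S.card * ∑ j, v j ^ 2 := by rw [Finset.sum_const, nsmul_eq_mul, mul_comm (X ^ 2)]

theorem quadForm_gram_le (hX : ∀ i j, |x i j| ≤ X) {v : Fin p → ℝ}
    (hv : ∀ j, j ∉ S → v j = 0) :
    quadForm (gram x) v ≤ X ^ 2 * S.card * ∑ j, v j ^ 2 := by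
  rw [quadForm_gram]
  refine div_le_of_le_mul₀ n.cast_nonneg (mul_nonneg (by positivity) (sum_sq_nonneg v)) ?_
  refine (Finset.sum_le_sum fun i _ => sq_sum_mul_le_of_support (hX i) hv).trans_eq ?_
  rw [Finset.sum_const, Finset.card_fin, nsmul_eq_mul, mul_comm]

theorem le_of_mem_rayleighSet (hX : ∀ i j, |x i j| ≤ X) {r : ℝ}
    (hr : r ∈ rayleighSet (gram x) S) : r ≤ X ^ 2 * S.card := by
  obtain ⟨v, hv, hvS, rfl⟩ := hr
  exact (div_le_iff₀ (sum_sq_pos hv)).mpr (quadForm_gram_le hX hvS)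

theorem nonneg_of_mem_rayleighSet {r : ℝ} (hr : r ∈ rayleighSet (gram x) S) : 0 ≤ r := by
  obtain ⟨v, -, -, rfl⟩ := hr
  exact div_nonneg (quadForm_gram_nonneg x v) (sum_sq_nonneg v)

theorem quadForm_le_sq_sparseEigMax_mul (hX : ∀ i j, |x i j| ≤ X) {v : Fin p → ℝ}
    (hv : ∀ j, j ∉ S → v j = 0) :
    quadForm (gram x) v ≤ sparseEigMax (gram x) S ^ 2 * ∑ j, v j ^ 2 := by
  rcases eq_or_ne v 0 with rfl | hv_ne
  · rw [quadForm_zero]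
    exact mul_nonneg (sq_nonneg _) (sum_sq_nonneg _)
  rw [← div_le_iff₀ (sum_sq_pos hv_ne), sparseEigMax,
    Real.sq_sqrt (Real.sSup_nonneg fun _ => nonneg_of_mem_rayleighSet)]
  exact le_csSup ⟨_, fun _ => le_of_mem_rayleighSet hX⟩ ⟨v, hv_ne, hv, rfl⟩

theorem sq_mul_le_quadForm_of_le_sparseEigMin (hc : 0 < c)
    (hS : c ≤ sparseEigMin (gram x) S) {v : Fin p → ℝ} (hv : ∀ j, j ∉ S → v j = 0) :
    c ^ 2 * ∑ j, v j ^ 2 ≤ quadForm (gram x) v := by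
  rcases eq_or_ne v 0 with rfl | hv_ne
  · simp only [quadForm_zero, Pi.zero_apply, zero_pow two_ne_zero, Finset.sum_const_zero,
      mul_zero, le_refl]
  rw [← le_div_iff₀ (sum_sq_pos hv_ne)]
  exact ((Real.le_sqrt' hc).mp hS).trans
    (csInf_le ⟨0, fun _ => nonneg_of_mem_rayleighSet⟩ ⟨v, hv_ne, hv, rfl⟩)

theorem sparseEigMax_le (hX_nonneg : 0 ≤ X) (hX : ∀ i j, |x i j| ≤ X) {m : ℕ}
    (hS : S.card ≤ m) : sparseEigMax (gram x) S ≤ X * Real.sqrt m := by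
  rw [sparseEigMax, ← Real.sqrt_sq hX_nonneg, ← Real.sqrt_mul (sq_nonneg X)]
  refine Real.sqrt_le_sqrt (Real.sSup_le (fun r hr => ?_) (by positivity))
  exact (le_of_mem_rayleighSet hX hr).trans (by gcongr)

theorem sparseEigMaxCard_le (hX_nonneg : 0 ≤ X) (hX : ∀ i j, |x i j| ≤ X) (m : ℕ) :
    sparseEigMaxCard (gram x) m ≤ X * Real.sqrt m := by
  refine Real.sSup_le ?_ (by positivity)
  rintro r ⟨S, hS, rfl⟩
  exact sparseEigMax_le hX_nonneg hX hS

theorem sparseEigMax_le_sparseEigMaxCard (hX_nonneg : 0 ≤ X) (hX : ∀ i j, |x i j| ≤ X) {m : ℕ}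
    (hS : S.card ≤ m) : sparseEigMax (gram x) S ≤ sparseEigMaxCard (gram x) m := by
  refine le_csSup ⟨X * Real.sqrt m, ?_⟩ ⟨S, hS, rfl⟩
  rintro r ⟨S', hS', rfl⟩
  exact sparseEigMax_le hX_nonneg hX hS'

theorem mixedNormOn_le_mul_fitNorm {δ : Fin T → Fin p → ℝ} (hc : 0 < c)
    (h : c ^ 2 * ∑ t, ∑ j ∈ S, δ t j ^ 2 ≤ fitNorm x δ ^ 2) :
    mixedNormOn S δ ≤ Real.sqrt S.card / c * fitNorm x δ := by
  refine le_of_sq_le_sq ?_ (mul_nonneg (by positivity) (fitNorm_nonneg x δ))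
  calc mixedNormOn S δ ^ 2 ≤ S.card * ∑ j ∈ S, colNorm δ j ^ 2 := sq_sum_le_card_mul_sum_sq
    _ = S.card / c ^ 2 * (c ^ 2 * ∑ t, ∑ j ∈ S, δ t j ^ 2) := by
        simp only [sq_colNorm]
        rw [Finset.sum_comm]
        field_simp
    _ ≤ S.card / c ^ 2 * fitNorm x δ ^ 2 := by gcongr
    _ = (Real.sqrt S.card / c * fitNorm x δ) ^ 2 := by
        rw [mul_pow, div_pow, Real.sq_sqrt (Nat.cast_nonneg _)]

theorem mixedNormOn_univ_le_of_sparseEigMin {δ : Fin T → Fin p → ℝ} {k : ℝ} (hc : 0 < c)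
    (hk : S.card ≤ k) (hS : S.Nonempty → c ≤ sparseEigMin (gram x) S)
    (hδ : ∀ t j, j ∉ S → δ t j = 0) :
    mixedNormOn Finset.univ δ ≤ Real.sqrt k / c * fitNorm x δ := by
  have hcompl : mixedNormOn Sᶜ δ = 0 := Finset.sum_eq_zero fun j hj => by
    simp only [hδ _ j (Finset.mem_compl.mp hj), zero_pow two_ne_zero, Finset.sum_const_zero,
      Real.sqrt_zero]
  have hsq : c ^ 2 * ∑ t, ∑ j ∈ S, δ t j ^ 2 ≤ fitNorm x δ ^ 2 := by
    rcases S.eq_empty_or_nonempty with rfl | hne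
    · simp only [Finset.sum_empty, Finset.sum_const_zero, mul_zero]
      positivity
    rw [← sum_quadForm_gram, Finset.mul_sum]
    refine Finset.sum_le_sum fun t _ =>
      le_trans ?_ (sq_mul_le_quadForm_of_le_sparseEigMin hc (hS hne) (hδ t))
    gcongr
    exact Finset.subset_univ S
  rw [← mixedNormOn_add_compl S, hcompl, add_zero]
  refine (mixedNormOn_le_mul_fitNorm hc hsq).trans ?_
  have := fitNorm_nonneg x δ
  gcongr

theorem mixedNormOn_le_of_isRestrictedEigenvalue {δ : Fin T → Fin p → ℝ} (hc : 0 < c)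
    (hre : IsRestrictedEigenvalue T (gram x) S c)
    (hcone : mixedNormOn Sᶜ δ ≤ 4 * mixedNormOn S δ) :
    mixedNormOn S δ ≤ Real.sqrt S.card / c * fitNorm x δ := by
  refine mixedNormOn_le_mul_fitNorm hc ?_
  rcases eq_or_ne δ 0 with rfl | hδ
  · simp only [Pi.zero_apply, zero_pow two_ne_zero, Finset.sum_const_zero, mul_zero]
    positivity
  rw [← sum_quadForm_gram]
  exact mul_le_of_le_div₀ (Finset.sum_nonneg fun _ _ => quadForm_gram_nonneg _ _)
    (Finset.sum_nonneg fun _ _ => Finset.sum_nonneg fun _ _ => sq_nonneg _) (hre δ hδ hcone)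

theorem IsRestrictedEigenvalue.mono {Q : Matrix (Fin p) (Fin p) ℝ} {κ : ℝ}
    (h : IsRestrictedEigenvalue T Q S κ) (hc : 0 ≤ c) (hcκ : c ≤ κ) :
    IsRestrictedEigenvalue T Q S c :=
  fun δ hδ hcone => (pow_le_pow_left₀ hc hcκ 2).trans (h δ hδ hcone)

theorem sum_sq_empMean_mul_le (hX : ∀ i j, |x i j| ≤ X) (r : Fin n → ℝ) :
    ∑ j ∈ S, empMean (fun i => x i j * r i) ^ 2
      ≤ sparseEigMax (gram x) S ^ 2 * empMean fun i => r i ^ 2 := by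
  let v : Fin p → ℝ := fun j => if j ∈ S then empMean fun i => x i j * r i else 0
  set s := ∑ j ∈ S, empMean (fun i => x i j * r i) ^ 2 with hs
  have hv_sq : ∑ j, v j ^ 2 = s := by
    simp only [v, ite_pow, zero_pow two_ne_zero, Finset.sum_ite_mem, Finset.univ_inter, hs]
  have hdual : empMean (fun i => r i * ∑ j, x i j * v j) = s := by
    simp only [Finset.mul_sum, ← mul_assoc, empMean_sum, empMean_mul_const, ← hv_sq, sq]
    refine Finset.sum_congr rfl fun j _ => ?_
    simp only [v, mul_comm (r _)]
    split_ifs <;> simp only [mul_zero]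
  have hs_nonneg : 0 ≤ s := Finset.sum_nonneg fun _ _ => sq_nonneg _
  have hr : 0 ≤ empMean fun i => r i ^ 2 := empMean_nonneg fun _ => sq_nonneg _
  have hquad := quadForm_le_sq_sparseEigMax_mul hX (S := S) (v := v) fun j hj => if_neg hj
  have hcs : s * s ≤ (sparseEigMax (gram x) S ^ 2 * empMean fun i => r i ^ 2) * s :=
    calc s * s = |empMean (fun i => r i * ∑ j, x i j * v j)| ^ 2 := by rw [hdual, sq_abs, sq]
      _ ≤ _ := pow_le_pow_left₀ (abs_nonneg _) (abs_empMean_mul_le _ _) 2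
      _ = (empMean fun i => r i ^ 2) * quadForm (gram x) v := by
          rw [mul_pow, Real.sq_sqrt hr, ← quadForm_gram, Real.sq_sqrt (quadForm_gram_nonneg x v)]
      _ ≤ (empMean fun i => r i ^ 2) * (sparseEigMax (gram x) S ^ 2 * s) := by
          rw [← hv_sq]
          gcongr
      _ = _ := by ring
  rcases hs_nonneg.eq_or_lt with hs_zero | hs_pos
  · rw [← hs_zero]
    exact mul_nonneg (sq_nonneg _) hr
  · exact le_of_mul_le_mul_right hcs hs_pos

end SparseEig

/-! ### The group lasso: estimation error -/

section GroupLasso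

variable {n T p s : ℕ} {x : Fin n → Fin p → ℝ} {d : Fin n → Fin (T + 1)}
  {π : Fin n → Fin T → ℝ} {γ γ' δ : Fin T → Fin p → ℝ} {X pmin lam b : ℝ}

theorem mixedNormOn_univ_sub_le (γ δ : Fin T → Fin p → ℝ) :
    mixedNormOn Finset.univ γ - mixedNormOn Finset.univ (γ + δ)
      ≤ mixedNormOn (suppUnion γ) δ - mixedNormOn (suppUnion γ)ᶜ δ := by
  rw [← mixedNormOn_add_compl (suppUnion γ) γ, ← mixedNormOn_add_compl (suppUnion γ) (γ + δ)]
  have hsupp : mixedNormOn (suppUnion γ) γ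
      ≤ mixedNormOn (suppUnion γ) (γ + δ) + mixedNormOn (suppUnion γ) δ := by
    simp only [mixedNormOn_eq, ← Finset.sum_add_distrib]
    refine Finset.sum_le_sum fun j _ => ?_
    simpa only [add_sub_cancel_right] using colNorm_sub_le (γ + δ) δ j
  have hγ_compl : mixedNormOn (suppUnion γ)ᶜ γ = 0 := Finset.sum_eq_zero fun j hj => by
    simp only [eq_zero_of_notMem_suppUnion (Finset.mem_compl.mp hj), zero_pow two_ne_zero,
      Finset.sum_const_zero, Real.sqrt_zero]
  have hadd_compl : mixedNormOn (suppUnion γ)ᶜ (γ + δ) = mixedNormOn (suppUnion γ)ᶜ δ :=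
    Finset.sum_congr rfl fun j hj => by
      simp only [Pi.add_apply, eq_zero_of_notMem_suppUnion (Finset.mem_compl.mp hj), zero_add]
  linarith

theorem IsGroupLasso.mlogitLoss_le (h : IsGroupLasso x d lam (γ + δ)) (hlam : 0 ≤ lam) :
    mlogitLoss x d (γ + δ) ≤ mlogitLoss x d γ
      + lam * (mixedNormOn (suppUnion γ) δ - mixedNormOn (suppUnion γ)ᶜ δ) := by
  have hpen := mul_le_mul_of_nonneg_left (mixedNormOn_univ_sub_le γ δ) hlam
  rw [mul_sub] at hpen
  linarith [h γ]

/-- The ratio of the mixed norm of the group lasso error to `√s` times its prediction norm. -/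
noncomputable def lassoConst (T : ℕ) (κ Cb : ℝ) : ℝ := 5 / κ + 3 * T * Cb

-- Outside the restricted eigenvalue cone the approximation error alone controls the mixed norm.
theorem RegularSample.mixedNormOn_groupLasso_le {κ Cb : ℝ}
    (hreg : RegularSample X pmin (lam / 8) b x d π γ) (hs : (suppUnion γ).card = s)
    (hlam : 0 < lam) (h : IsGroupLasso x d lam (γ + δ)) (hκ : 0 < κ)
    (hre : IsRestrictedEigenvalue T (gram x) (suppUnion γ) κ) (hCb : 0 ≤ Cb)
    (hb : b ≤ Cb * (lam * Real.sqrt s)) :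
    mixedNormOn Finset.univ δ ≤ lassoConst T κ Cb * Real.sqrt s * fitNorm x δ := by
  have hbasic := (empMean_nonneg fun i =>
    logitBregman_nonneg (logOdds γ (x i)) (logOdds δ (x i))).trans
      (hreg.empMean_logitBregman_le (h.mlogitLoss_le hlam.le))
  have hin_nonneg := mixedNormOn_nonneg (suppUnion γ) δ
  have hout_nonneg := mixedNormOn_nonneg (suppUnion γ)ᶜ δ
  have hcone_bound := mixedNormOn_le_of_isRestrictedEigenvalue (δ := δ) hκ hre
  rw [← mixedNormOn_add_compl (suppUnion γ)] at hbasic ⊢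
  rw [hs] at hcone_bound
  set inner := mixedNormOn (suppUnion γ) δ
  set outer := mixedNormOn (suppUnion γ)ᶜ δ
  set q := fitNorm x δ
  set r := Real.sqrt s
  have hq : 0 ≤ q := fitNorm_nonneg x δ
  have hconst : lassoConst T κ Cb * r * q = 5 * (r / κ * q) + 3 * (T * Cb * r * q) := by
    rw [lassoConst]
    ring
  rw [hconst]
  have hre_nonneg : 0 ≤ r / κ * q := by positivity
  have hbias_nonneg : 0 ≤ T * Cb * r * q := by positivity
  rcases le_or_gt outer (4 * inner) with hcone | hcone
  · linarith [hcone_bound hcone]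
  · have hbias : T * b * q ≤ lam * (T * Cb * r * q) :=
      calc T * b * q ≤ T * (Cb * (lam * r)) * q := by gcongr
        _ = lam * (T * Cb * r * q) := by ring
    have houter : 19 / 32 * outer ≤ T * Cb * r * q :=
      le_of_mul_le_mul_left (by nlinarith) hlam
    linarith

theorem RegularSample.fitNorm_groupLasso_le {L : ℝ}
    (hreg : RegularSample X pmin (lam / 8) b x d π γ) (hlam : 0 ≤ lam)
    (h : IsGroupLasso x d lam (γ + δ)) (hL : 0 ≤ L)
    (hmix : mixedNormOn Finset.univ δ ≤ L * Real.sqrt s * fitNorm x δ)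
    (hloc : X * L * (lam * s + b * Real.sqrt s) ≤ localRadius T pmin (2 * L + T)) :
    fitNorm x δ ≤ errorConst pmin (2 * L + T) * (lam * Real.sqrt s + b) := by
  have hb := hreg.bias_nonneg
  have hq := fitNorm_nonneg x δ
  have hlam_s : 0 ≤ lam * Real.sqrt s := by positivity
  set r := Real.sqrt s
  set q := fitNorm x δ
  have hU : mlogitLoss x d (γ + δ)
      ≤ mlogitLoss x d γ + lam * mixedNormOn Finset.univ δ := by
    refine (h.mlogitLoss_le hlam).trans ?_
    rw [← mixedNormOn_add_compl (suppUnion γ)]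
    gcongr
    linarith [mixedNormOn_nonneg (suppUnion γ)ᶜ δ]
  refine hreg.fitNorm_le (by positivity) (by positivity) (by linarith) hmix hU ?_ ?_
  · calc lam * mixedNormOn Finset.univ δ + lam / 8 * mixedNormOn Finset.univ δ + T * b * q
        ≤ 2 * (lam * mixedNormOn Finset.univ δ) + T * b * q := by
          nlinarith [mul_nonneg hlam (mixedNormOn_nonneg Finset.univ δ)]
      _ ≤ 2 * (lam * (L * r * q)) + T * b * q := by gcongr
      _ = 2 * L * (lam * r) * q + T * b * q := by ring
      _ ≤ 2 * L * (lam * r + b) * (lam * r + b + q) + T * (lam * r + b) * (lam * r + b + q) := by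
          gcongr <;> linarith
      _ = (2 * L + T) * (lam * r + b) * (lam * r + b + q) := by ring
  · refine Eq.trans_le ?_ hloc
    linear_combination (X * L * lam) * Real.mul_self_sqrt s.cast_nonneg

theorem mixedNormOn_add_smul_single {τ : ℝ} (hτ : -1 ≤ τ) (γ : Fin T → Fin p → ℝ) (j : Fin p) :
    mixedNormOn Finset.univ (γ + τ • fun t => Pi.single j (γ t j))
      = mixedNormOn Finset.univ γ + τ * colNorm γ j := by
  have hj : colNorm (γ + τ • fun t => Pi.single j (γ t j)) j = (1 + τ) * colNorm γ j := by
    have hcol : ∀ t, γ t j + τ * γ t j = (1 + τ) * γ t j := fun t => by ring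
    simp only [colNorm, Pi.add_apply, Pi.smul_apply, Pi.single_eq_same, smul_eq_mul, hcol,
      mul_pow, ← Finset.mul_sum]
    rw [Real.sqrt_mul (sq_nonneg _), Real.sqrt_sq (by linarith)]
  have hne : ∀ k ∈ Finset.univ.erase j,
      colNorm (γ + τ • fun t => Pi.single j (γ t j)) k = colNorm γ k := fun k hk => by
    simp only [colNorm, Pi.add_apply, Pi.smul_apply,
      Pi.single_eq_of_ne (Finset.ne_of_mem_erase hk), smul_zero, add_zero]
  rw [mixedNormOn_eq, mixedNormOn_eq, ← Finset.add_sum_erase _ _ (Finset.mem_univ j),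
    ← Finset.add_sum_erase _ (colNorm γ) (Finset.mem_univ j), hj, Finset.sum_congr rfl hne]
  ring

theorem hasDerivAt_logitBregman_smul (w h : Fin T → ℝ) :
    HasDerivAt (fun τ : ℝ => logitBregman w (τ • h)) 0 0 := by
  have hexp : ∀ t, HasDerivAt (fun τ : ℝ => Real.exp (w t + τ * h t)) (Real.exp (w t) * h t) 0 :=
    fun t => by simpa using (((hasDerivAt_id (0 : ℝ)).mul_const (h t)).const_add (w t)).exp
  have hlog := ((HasDerivAt.fun_sum fun t (_ : t ∈ Finset.univ) => hexp t).const_add 1).log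
    (by simpa using (one_add_sum_exp_pos w).ne')
  have hlin := HasDerivAt.fun_sum fun t (_ : t ∈ Finset.univ) =>
    ((hasDerivAt_id (0 : ℝ)).mul_const (h t)).const_mul (mlogit w t)
  simp only [logitBregman, Pi.smul_apply, smul_eq_mul]
  refine ((hlog.sub_const (Real.log (1 + ∑ t, Real.exp (w t)))).sub hlin).congr_deriv ?_
  simp only [mlogit, zero_mul, add_zero, one_mul, Finset.sum_div, div_mul_eq_mul_div, sub_self]

theorem hasDerivAt_mlogitLoss_add_smul (x : Fin n → Fin p → ℝ) (d : Fin n → Fin (T + 1))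
    (γ v : Fin T → Fin p → ℝ) :
    HasDerivAt (fun τ : ℝ => mlogitLoss x d (γ + τ • v))
      (∑ t, ∑ j, lossGrad x d γ t j * v t j) 0 := by
  have hlin := ((hasDerivAt_id (0 : ℝ)).mul_const
    (∑ t, ∑ j, lossGrad x d γ t j * v t j)).const_add (mlogitLoss x d γ)
  have hbregman := (HasDerivAt.fun_sum fun i (_ : i ∈ Finset.univ) =>
    hasDerivAt_logitBregman_smul (logOdds γ (x i)) (logOdds v (x i))).div_const (n : ℝ)
  simp only [mlogitLoss_add, logOdds_smul, empMean, Pi.smul_apply, smul_eq_mul,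
    mul_left_comm _ (_ : ℝ) (v _ _), ← Finset.mul_sum]
  refine (hlin.add hbregman).congr_deriv ?_
  simp only [Finset.sum_const_zero, zero_div, add_zero, one_mul]

/- Moving column `j` of `γ` radially changes the penalty linearly, so the objective is
differentiable in that direction although the penalty is not differentiable. -/
theorem IsGroupLasso.sum_lossGrad_mul (h : IsGroupLasso x d lam γ) (j : Fin p) :
    ∑ t, lossGrad x d γ t j * γ t j = -(lam * colNorm γ j) := by
  have hmin : IsLocalMin (fun τ : ℝ => mlogitLoss x d (γ + τ • fun t => Pi.single j (γ t j))
      + lam * (mixedNormOn Finset.univ γ + τ * colNorm γ j)) 0 := by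
    filter_upwards [Ioi_mem_nhds (show (-1 : ℝ) < 0 by norm_num)] with τ hτ
    rw [← mixedNormOn_add_smul_single (Set.mem_Ioi.mp hτ).le]
    simpa only [zero_smul, add_zero, zero_mul] using h _
  have hderiv := hmin.hasDerivAt_eq_zero
    ((hasDerivAt_mlogitLoss_add_smul x d γ fun t => Pi.single j (γ t j)).add
      ((((hasDerivAt_id (0 : ℝ)).mul_const (colNorm γ j)).const_add _).const_mul lam))
  simp only [Pi.single_apply, mul_ite, mul_zero, Finset.sum_ite_eq', Finset.mem_univ, if_true,
    one_mul] at hderiv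
  linarith

theorem IsGroupLasso.le_colNorm_lossGrad (h : IsGroupLasso x d lam γ) {j : Fin p}
    (hj : j ∈ suppUnion γ) : lam ≤ colNorm (lossGrad x d γ) j := by
  refine le_of_mul_le_mul_right ?_ (mem_suppUnion.mp hj)
  calc lam * colNorm γ j = -∑ t, lossGrad x d γ t j * γ t j := by
        rw [h.sum_lossGrad_mul, neg_neg]
    _ ≤ |∑ t, lossGrad x d γ t j * γ t j| := neg_le_abs _
    _ ≤ colNorm (lossGrad x d γ) j * colNorm γ j := abs_sum_mul_le_colNorm_mul _ _ _

theorem RegularSample.card_mul_sq_le (hreg : RegularSample X pmin (lam / 8) b x d π γ)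
    (hlam : 0 ≤ lam) (h : IsGroupLasso x d lam γ') {A : Finset (Fin p)}
    (hA : A ⊆ suppUnion γ') :
    A.card * lam ^ 2 ≤ 4 * (sparseEigMax (gram x) A ^ 2 * ∑ t, fitMSE x π γ' t) := by
  set bias : Fin T → Fin p → ℝ := fun t j =>
    empMean fun i => x i j * (mlogit (logOdds γ' (x i)) t - π i t)
  have hgrad : lossGrad x d γ' = bias - score x d π := by
    funext t j
    exact lossGrad_eq x d π γ' t j
  have hcol : ∀ j ∈ A, lam / 2 ≤ colNorm bias j := fun j hj => by
    have hkkt := h.le_colNorm_lossGrad (hA hj)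
    rw [hgrad] at hkkt
    linarith [colNorm_sub_le bias (score x d π) j, hreg.score_le j]
  calc (A.card : ℝ) * lam ^ 2 = 4 * ∑ _j ∈ A, (lam / 2) ^ 2 := by
        rw [Finset.sum_const, nsmul_eq_mul]
        ring
    _ ≤ 4 * ∑ j ∈ A, colNorm bias j ^ 2 := by
        gcongr with j hj
        exact hcol j hj
    _ = 4 * ∑ t, ∑ j ∈ A, bias t j ^ 2 := by
        simp only [sq_colNorm]
        rw [Finset.sum_comm]
    _ ≤ 4 * ∑ t, sparseEigMax (gram x) A ^ 2 * fitMSE x π γ' t := by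
        gcongr with t
        exact sum_sq_empMean_mul_le hreg.bounded _
    _ = _ := by rw [← Finset.mul_sum]

theorem card_le_of_forall_subset_card_le {α : Type*} {S : Finset α} {m : ℕ} {k : ℝ}
    (hkm : k < m) (h : ∀ A ⊆ S, A.card ≤ m → (A.card : ℝ) ≤ k) : (S.card : ℝ) ≤ k := by
  rcases le_or_gt S.card m with hle | hgt
  · exact h S subset_rfl hle
  · obtain ⟨A, hAS, rfl⟩ := Finset.exists_subset_card_eq hgt.le
    exact absurd (h A hAS le_rfl) hkm.not_ge

theorem RegularSample.card_suppUnion_groupLasso_le {φ V : ℝ} {m : ℕ}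
    (hreg : RegularSample X pmin (lam / 8) b x d π γ) (hlam : 0 < lam)
    (h : IsGroupLasso x d lam γ')
    (hmse : ∀ t, fitMSE x π γ' t ≤ V * (lam ^ 2 * s))
    (hφ : sparseEigMaxCard (gram x) m ≤ φ) (hm : 4 * φ ^ 2 * T * V * s < m) :
    ((suppUnion γ').card : ℝ) ≤ 4 * φ ^ 2 * T * V * s := by
  refine card_le_of_forall_subset_card_le hm fun A hA hAm => ?_
  have hφA := (sparseEigMax_le_sparseEigMaxCard hreg.bound_nonneg hreg.bounded hAm).trans hφ
  refine le_of_mul_le_mul_right ?_ (pow_pos hlam 2)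
  calc (A.card : ℝ) * lam ^ 2
      ≤ 4 * (sparseEigMax (gram x) A ^ 2 * ∑ t, fitMSE x π γ' t) :=
        hreg.card_mul_sq_le hlam.le h hA
    _ ≤ 4 * (φ ^ 2 * ∑ _t : Fin T, V * (lam ^ 2 * s)) := by
        gcongr with t
        · exact Finset.sum_nonneg fun t _ => empMean_nonneg fun i => sq_nonneg _
        · exact Real.sqrt_nonneg _
        · exact hmse t
    _ = 4 * φ ^ 2 * T * V * s * lam ^ 2 := by
        rw [Finset.sum_const, Finset.card_fin, nsmul_eq_mul]
        ring

theorem RegularSample.fitMSE_le_of_fitNorm_le {σ C : ℝ} (hreg : RegularSample X pmin σ b x d π γ)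
    (hfit : fitNorm x δ ≤ C * (lam * Real.sqrt s + b)) (t : Fin T) :
    fitMSE x π (γ + δ) t ≤ (2 + 16 * C ^ 2) * (lam ^ 2 * s + b ^ 2) := by
  have hsq : (lam * Real.sqrt s + b) ^ 2 ≤ 2 * (lam ^ 2 * s + b ^ 2) := by
    have hr : (lam * Real.sqrt s) ^ 2 = lam ^ 2 * s := by
      rw [mul_pow, Real.sq_sqrt s.cast_nonneg]
    linarith [add_sq_le (a := lam * Real.sqrt s) (b := b)]
  have hlam_s : 0 ≤ lam ^ 2 * s := by positivity
  calc fitMSE x π (γ + δ) t ≤ 2 * fitMSE x π γ t + 8 * fitNorm x δ ^ 2 :=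
        fitMSE_add_le x π γ δ t
    _ ≤ 2 * b ^ 2 + 8 * (C * (lam * Real.sqrt s + b)) ^ 2 := by
        gcongr
        · exact hreg.bias_le t
        · exact fitNorm_nonneg x δ
    _ ≤ 2 * b ^ 2 + 8 * (C ^ 2 * (2 * (lam ^ 2 * s + b ^ 2))) := by
        rw [mul_pow]
        gcongr
    _ ≤ (2 + 16 * C ^ 2) * (lam ^ 2 * s + b ^ 2) := by linarith

end GroupLasso

/-! ### The refit -/

section Refit

variable {n T p s : ℕ} {x : Fin n → Fin p → ℝ} {d : Fin n → Fin (T + 1)}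
  {π : Fin n → Fin T → ℝ} {γ δ δ' : Fin T → Fin p → ℝ} {X pmin lam b L : ℝ}
  {S : Finset (Fin p)}

theorem mixedNormOn_univ_le_of_suppUnion_subset {M c : ℝ} (hs : (suppUnion γ).card = s)
    (hS : (S.card : ℝ) ≤ M * s) (hM : 0 ≤ M) (hc : 0 < c)
    (heig : ∀ S' : Finset (Fin p), S'.Nonempty → (S'.card : ℝ) ≤ (M + 1) * s →
      c ≤ sparseEigMin (gram x) S')
    (hsub : suppUnion (γ + δ) ⊆ S) :
    mixedNormOn Finset.univ δ ≤ Real.sqrt (M + 1) / c * Real.sqrt s * fitNorm x δ := by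
  have hcard : ((S ∪ suppUnion γ).card : ℝ) ≤ (M + 1) * s := by
    have hunion : ((S ∪ suppUnion γ).card : ℝ) ≤ S.card + (suppUnion γ).card := by
      exact_mod_cast Finset.card_union_le _ _
    rw [hs] at hunion
    linarith
  have hsupport : ∀ t j, j ∉ S ∪ suppUnion γ → δ t j = 0 := fun t j hj => by
    obtain ⟨hjS, hjγ⟩ := Finset.notMem_union.mp hj
    have hsum := eq_zero_of_notMem_suppUnion (fun hmem => hjS (hsub hmem)) t
    rwa [Pi.add_apply, Pi.add_apply, eq_zero_of_notMem_suppUnion hjγ, zero_add] at hsum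
  refine (mixedNormOn_univ_le_of_sparseEigMin hc hcard (fun hne => heig _ hne hcard)
    hsupport).trans_eq ?_
  rw [Real.sqrt_mul (by positivity)]
  ring

/-- The factor `K` of the localized error bound `RegularSample.fitNorm_le` for the refit. -/
noncomputable def refitFactor (T : ℕ) (pmin L : ℝ) : ℝ :=
  L * errorConst pmin (2 * L + T) + L + T

theorem errorConst_pos {K : ℝ} (pmin : ℝ) (hK : 0 ≤ K) : 0 < errorConst pmin K := by
  rw [errorConst]
  positivity

theorem IsGroupLasso.mlogitLoss_le_of_fitNorm_le {C : ℝ} (h : IsGroupLasso x d lam (γ + δ))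
    (hlam : 0 ≤ lam) (hb : 0 ≤ b) (hL : 0 ≤ L) (hC : 0 ≤ C)
    (hmix : mixedNormOn Finset.univ δ ≤ L * Real.sqrt s * fitNorm x δ)
    (hfit : fitNorm x δ ≤ C * (lam * Real.sqrt s + b)) :
    mlogitLoss x d (γ + δ) ≤ mlogitLoss x d γ + L * C * (lam * Real.sqrt s + b) ^ 2 := by
  have hlam_s : 0 ≤ lam * Real.sqrt s := by positivity
  have hdiff : mixedNormOn (suppUnion γ) δ - mixedNormOn (suppUnion γ)ᶜ δ
      ≤ L * Real.sqrt s * (C * (lam * Real.sqrt s + b)) :=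
    calc _ ≤ mixedNormOn Finset.univ δ := by
          rw [← mixedNormOn_add_compl (suppUnion γ)]
          linarith [mixedNormOn_nonneg (suppUnion γ)ᶜ δ]
      _ ≤ L * Real.sqrt s * fitNorm x δ := hmix
      _ ≤ L * Real.sqrt s * (C * (lam * Real.sqrt s + b)) := by gcongr
  calc mlogitLoss x d (γ + δ)
      ≤ mlogitLoss x d γ + lam * (L * Real.sqrt s * (C * (lam * Real.sqrt s + b))) :=
        (h.mlogitLoss_le hlam).trans (by gcongr)
    _ = mlogitLoss x d γ + L * C * ((lam * Real.sqrt s) * (lam * Real.sqrt s + b)) := by ring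
    _ ≤ mlogitLoss x d γ + L * C * ((lam * Real.sqrt s + b) * (lam * Real.sqrt s + b)) := by
        gcongr
        linarith
    _ = mlogitLoss x d γ + L * C * (lam * Real.sqrt s + b) ^ 2 := by rw [sq]

-- The loss of the refit is at most that of the group lasso, which is itself close to that of `γ`.
theorem RegularSample.fitNorm_refit_le (hreg : RegularSample X pmin (lam / 8) b x d π γ)
    (hlam : 0 ≤ lam) (h : IsGroupLasso x d lam (γ + δ)) (hsub : suppUnion (γ + δ) ⊆ S)
    (hrefit : IsRefit x d S (γ + δ')) (hL : 0 ≤ L)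
    (hmix : ∀ ζ : Fin T → Fin p → ℝ, suppUnion (γ + ζ) ⊆ S →
      mixedNormOn Finset.univ ζ ≤ L * Real.sqrt s * fitNorm x ζ)
    (hloc : X * L * (lam * s + b * Real.sqrt s) ≤ localRadius T pmin (2 * L + T))
    (hloc' : X * L * (lam * s + b * Real.sqrt s) ≤ localRadius T pmin (refitFactor T pmin L)) :
    fitNorm x δ' ≤ errorConst pmin (refitFactor T pmin L) * (lam * Real.sqrt s + b) := by
  have hb := hreg.bias_nonneg
  have hq' := fitNorm_nonneg x δ'
  have hC := (errorConst_pos pmin (show 0 ≤ 2 * L + T by positivity)).le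
  have hlam_s : 0 ≤ lam * Real.sqrt s := by positivity
  have hloss := (hrefit.2 _ hsub).trans (h.mlogitLoss_le_of_fitNorm_le hlam hb hL hC (hmix δ hsub)
    (hreg.fitNorm_groupLasso_le hlam h hL (hmix δ hsub) hloc))
  rw [refitFactor] at hloc' ⊢
  set C := errorConst pmin (2 * L + T)
  set e := lam * Real.sqrt s + b
  set q' := fitNorm x δ'
  have hlam_mix : lam * mixedNormOn Finset.univ δ' ≤ L * e * q' :=
    calc lam * mixedNormOn Finset.univ δ' ≤ lam * (L * Real.sqrt s * q') := by
          gcongr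
          exact hmix δ' hrefit.1
      _ = L * (lam * Real.sqrt s) * q' := by ring
      _ ≤ L * e * q' := by
          gcongr
          linarith
  refine hreg.fitNorm_le (by positivity) (by positivity) (by linarith) (hmix δ' hrefit.1) hloss
    ?_ ?_
  · have hbias : T * b * q' ≤ T * e * q' := by
      gcongr
      linarith
    have hslack : 0 ≤ (L + T) * e ^ 2 + L * C * e * q' := by positivity
    linarith [mul_nonneg hlam (mixedNormOn_nonneg Finset.univ δ')]
  · refine Eq.trans_le ?_ hloc'
    linear_combination (X * L * lam) * Real.mul_self_sqrt s.cast_nonneg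

end Refit

/-! ### The sparsity factor -/

section SparsityFactor

theorem abs_errorBound_le {T s : ℕ} {pmin κ₀ κ lam b Cb : ℝ} (AK : ℝ) (hpmin : 0 < pmin)
    (hκ₀ : 0 < κ₀) (hκ : κ₀ ≤ κ) (hlam : 0 ≤ lam) (hb_nonneg : 0 ≤ b)
    (hb_pmin : b ≤ pmin / 2) (hb : b ≤ Cb * (lam * Real.sqrt s)) :
    |errorBound T pmin AK κ lam b s|
      ≤ (2 / pmin) ^ (T + 1) * T * |AK| * (6 / κ₀ + 8 * Cb * Real.sqrt T)
        * (lam * Real.sqrt s) := by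
  have hgap : 0 < pmin - b := by linarith
  have hAp : pmin / max 0 (pmin - b) / pmin ≤ 2 / pmin := by
    rw [max_eq_right hgap.le, div_right_comm, div_self hpmin.ne', div_le_div_iff₀ hgap hpmin]
    linarith
  have hAp_nonneg : 0 ≤ pmin / max 0 (pmin - b) / pmin := by positivity
  have hlam_s : 0 ≤ lam * Real.sqrt s := by positivity
  have hκ_pos : 0 < κ := hκ₀.trans_le hκ
  have hrate : 0 ≤ 6 * (lam * Real.sqrt s / κ) + 8 * b * Real.sqrt T := by positivity
  rw [errorBound, abs_mul, abs_mul, abs_of_nonneg hrate,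
    abs_of_nonneg (show 0 ≤ (pmin / max 0 (pmin - b) / pmin) ^ (T + 1) * T by positivity)]
  calc (pmin / max 0 (pmin - b) / pmin) ^ (T + 1) * T * |AK|
        * (6 * (lam * Real.sqrt s / κ) + 8 * b * Real.sqrt T)
      ≤ (2 / pmin) ^ (T + 1) * T * |AK|
        * (6 * (lam * Real.sqrt s / κ₀) + 8 * (Cb * (lam * Real.sqrt s)) * Real.sqrt T) := by
        gcongr
    _ = _ := by ring

theorem sparsityFactor_le {T s : ℕ} {pmin κ₀ κ lam b Cb : ℝ} (AK : ℝ) (hpmin : 0 < pmin)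
    (hκ₀ : 0 < κ₀) (hκ : κ₀ ≤ κ) (hlam : 0 ≤ lam) (hb_nonneg : 0 ≤ b)
    (hb_pmin : b ≤ pmin / 2) (hCb : 0 ≤ Cb) (hb : b ≤ Cb * (lam * Real.sqrt s)) :
    sparsityFactor T pmin AK κ lam b s
      ≤ T * ((2 / pmin) ^ (T + 1) * T * |AK| * (6 / κ₀ + 8 * Cb * Real.sqrt T) + Cb) ^ 2 := by
  rw [sparsityFactor]
  refine mul_le_mul_of_nonneg_left (sq_le_sq.mpr ?_) T.cast_nonneg
  rw [abs_div, abs_of_nonneg (show 0 ≤ lam * Real.sqrt s by positivity)]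
  refine (div_le_of_le_mul₀ (by positivity) (by positivity) ?_).trans (le_abs_self _)
  refine (abs_add_le _ _).trans ?_
  rw [add_mul, abs_of_nonneg hb_nonneg]
  exact add_le_add (abs_errorBound_le AK hpmin hκ₀ hκ hlam hb_nonneg hb_pmin hb) hb

end SparsityFactor

/-! ### Stochastic orders -/

section StochasticOrder

variable {Ω : ℕ → Type*} [∀ n, MeasurableSpace (Ω n)] {μ : ∀ n, Measure (Ω n)}
  {E F : ∀ n, Set (Ω n)} {X Y : ∀ n, Ω n → ℝ} {a a' : ℕ → ℝ}

theorem wpa1_of_ae (h : ∀ n, ∀ᵐ ω ∂μ n, ω ∈ E n) : WPA1 μ E := by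
  have hzero : (fun n => μ n (E n)ᶜ) = fun _ => 0 := funext fun n => h n
  rw [WPA1, hzero]
  exact tendsto_const_nhds

theorem WPA1.inter (hE : WPA1 μ E) (hF : WPA1 μ F) : WPA1 μ fun n => E n ∩ F n := by
  have hsum : Tendsto (fun n => μ n (E n)ᶜ + μ n (F n)ᶜ) atTop (𝓝 0) := by
    simpa only [add_zero] using hE.add hF
  refine tendsto_of_tendsto_of_tendsto_of_le_of_le tendsto_const_nhds hsum (fun _ => zero_le)
    fun n => ?_
  simp only [Set.compl_inter]
  exact measure_union_le _ _

theorem WPA1.mono (hE : WPA1 μ E) (h : ∀ᶠ n in atTop, E n ⊆ F n) : WPA1 μ F :=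
  tendsto_of_tendsto_of_tendsto_of_le_of_le' tendsto_const_nhds hE
    (Eventually.of_forall fun _ => zero_le)
    (h.mono fun _ hn => measure_mono (Set.compl_subset_compl.mpr hn))

theorem WPA1.eventually_measure_compl_le (hE : WPA1 μ E) {ε : ℝ} (hε : 0 < ε) :
    ∀ᶠ n in atTop, μ n (E n)ᶜ ≤ ENNReal.ofReal ε :=
  (hE.eventually (gt_mem_nhds (ENNReal.ofReal_pos.mpr hε))).mono fun _ h => h.le

theorem WPA1.eventually_nonempty [∀ n, IsProbabilityMeasure (μ n)] (hE : WPA1 μ E) :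
    ∀ᶠ n in atTop, (E n).Nonempty := by
  filter_upwards [hE.eventually (gt_mem_nhds zero_lt_one)] with n hn
  rw [Set.nonempty_iff_ne_empty]
  intro hempty
  rw [hempty, Set.compl_empty, measure_univ] at hn
  exact lt_irrefl _ hn

theorem measure_union_le_ofReal {α : Type*} [MeasurableSpace α] {ν : Measure α} {A B : Set α}
    {ε : ℝ} (hε : 0 < ε) (hA : ν A ≤ ENNReal.ofReal (ε / 2)) (hB : ν B ≤ ENNReal.ofReal (ε / 2)) :
    ν (A ∪ B) ≤ ENNReal.ofReal ε :=
  calc ν (A ∪ B) ≤ ENNReal.ofReal (ε / 2) + ENNReal.ofReal (ε / 2) :=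
        (measure_union_le A B).trans (add_le_add hA hB)
    _ = ENNReal.ofReal ε := by
        rw [← ENNReal.ofReal_add (half_pos hε).le (half_pos hε).le, add_halves]

theorem isOP_of_wpa1 {C : ℝ} (hC : 0 < C) (h : WPA1 μ fun n => {ω | |X n ω| ≤ C * a n}) :
    IsOP μ X a := by
  intro ε hε
  refine ⟨C, hC, (h.eventually_measure_compl_le hε).mono fun n hn => ?_⟩
  exact (measure_mono fun ω (hω : C * a n < |X n ω|) => not_le.mpr hω).trans hn

theorem IsOP.of_bound (hY : IsOP μ Y a)
    (h : ∀ M : ℝ, 0 < M → ∃ C : ℝ, 0 < C ∧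
      WPA1 μ fun n => {ω | |Y n ω| ≤ M * a n → |X n ω| ≤ C * a' n}) :
    IsOP μ X a' := by
  intro ε hε
  obtain ⟨M, hM, hYM⟩ := hY (ε / 2) (half_pos hε)
  obtain ⟨C, hC, hE⟩ := h M hM
  refine ⟨C, hC, ?_⟩
  filter_upwards [hYM, hE.eventually_measure_compl_le (half_pos hε)] with n hYn hEn
  refine (measure_mono fun ω hω => ?_).trans (measure_union_le_ofReal hε hYn hEn)
  rcases lt_or_ge (M * a n) |Y n ω| with hlarge | hsmall
  · exact Or.inl hlarge
  · exact Or.inr fun himp => absurd (himp hsmall) (not_le.mpr hω)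

theorem IsOP.add (hX : IsOP μ X a) (hY : IsOP μ Y a) : IsOP μ (fun n ω => X n ω + Y n ω) a := by
  intro ε hε
  obtain ⟨M, hM, hXM⟩ := hX (ε / 2) (half_pos hε)
  obtain ⟨M', hM', hYM⟩ := hY (ε / 2) (half_pos hε)
  refine ⟨M + M', add_pos hM hM', ?_⟩
  filter_upwards [hXM, hYM] with n hXn hYn
  refine (measure_mono fun ω hω => ?_).trans (measure_union_le_ofReal hε hXn hYn)
  rw [Set.mem_ofPred_eq, add_mul] at hω
  exact lt_or_lt_of_add_lt_add (hω.trans_le (abs_add_le _ _))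

theorem IsOP.of_abs_le (hY : IsOP μ Y a) (h : ∀ n ω, |X n ω| ≤ |Y n ω|) : IsOP μ X a := by
  intro ε hε
  obtain ⟨M, hM, hYM⟩ := hY ε hε
  exact ⟨M, hM, hYM.mono fun n hn =>
    (measure_mono fun ω hω => lt_of_lt_of_le hω (h n ω)).trans hn⟩

theorem IsOP.trans_le (hX : IsOP μ X a) {C : ℝ} (hC : 0 < C)
    (h : ∀ᶠ n in atTop, a n ≤ C * a' n) : IsOP μ X a' := by
  intro ε hε
  obtain ⟨M, hM, hXM⟩ := hX ε hε
  refine ⟨M * C, mul_pos hM hC, ?_⟩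
  filter_upwards [hXM, h] with n hXn hn
  refine (measure_mono fun ω (hω : M * C * a' n < |X n ω|) => ?_).trans hXn
  calc M * a n ≤ M * (C * a' n) := mul_le_mul_of_nonneg_left hn hM.le
    _ = M * C * a' n := (mul_assoc _ _ _).symm
    _ < |X n ω| := hω

end StochasticOrder

/-! ### Concentration of the score -/

section Hoeffding

variable {Ω : Type*} [MeasurableSpace Ω] {μ : Measure Ω} {n : ℕ} {Y : Fin n → Ω → ℝ}

theorem measureReal_le_empMean_le {c : NNReal} (hindep : iIndepFun Y μ)
    (hsub : ∀ i, HasSubgaussianMGF (Y i) c μ) {u : ℝ} (hu : 0 ≤ u) :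
    μ.real {ω | u ≤ empMean fun i => Y i ω} ≤ Real.exp (-(n * u ^ 2 / (2 * c))) := by
  have := hindep.isProbabilityMeasure
  have hsubset : {ω | u ≤ empMean fun i => Y i ω} ⊆ {ω | n * u ≤ ∑ i, Y i ω} := fun ω hω => by
    rcases n.eq_zero_or_pos with rfl | hn
    · simp
    · rw [Set.mem_ofPred_eq, empMean, le_div_iff₀ (by exact_mod_cast hn)] at hω
      exact (mul_comm _ _).trans_le hω
  refine (measureReal_mono hsubset).trans
    ((HasSubgaussianMGF.measure_sum_ge_le_of_iIndepFun hindep (fun i _ => hsub i)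
      (by positivity)).trans_eq (congrArg Real.exp ?_))
  rw [Finset.sum_const, Finset.card_univ, Fintype.card_fin, nsmul_eq_mul, NNReal.coe_mul,
    NNReal.coe_natCast]
  rcases n.eq_zero_or_pos with rfl | hn
  · simp
  · field_simp

theorem measureReal_le_abs_empMean_le {c : NNReal} (hindep : iIndepFun Y μ)
    (hsub : ∀ i, HasSubgaussianMGF (Y i) c μ) {u : ℝ} (hu : 0 ≤ u) :
    μ.real {ω | u ≤ |empMean fun i => Y i ω|} ≤ 2 * Real.exp (-(n * u ^ 2 / (2 * c))) := by
  have := hindep.isProbabilityMeasure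
  have hupper := measureReal_le_empMean_le hindep hsub hu
  have hlower := measureReal_le_empMean_le (hindep.comp (fun _ y => -y) fun _ => measurable_neg)
    (fun i => (hsub i).neg) hu
  refine (measureReal_mono fun ω hω => ?_).trans
    ((measureReal_union_le _ _).trans ((add_le_add hupper hlower).trans_eq (two_mul _).symm))
  rw [Set.mem_ofPred_eq, le_abs] at hω
  refine hω.imp id fun hneg => hneg.trans_eq ?_
  simp [empMean, neg_div]

theorem measureReal_le_abs_empMean_le_of_abs_le {X u : ℝ} (hindep : iIndepFun Y μ)
    (hmeas : ∀ i, AEMeasurable (Y i) μ) (hbound : ∀ i, ∀ᵐ ω ∂μ, |Y i ω| ≤ X)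
    (hmean : ∀ i, ∫ ω, Y i ω ∂μ = 0) (hu : 0 ≤ u) :
    μ.real {ω | u ≤ |empMean fun i => Y i ω|} ≤ 2 * Real.exp (-(n * u ^ 2 / (2 * X ^ 2))) := by
  have := hindep.isProbabilityMeasure
  have hX : (((‖X - -X‖₊ / 2) ^ 2 : NNReal) : ℝ) = X ^ 2 := by
    rw [NNReal.coe_pow, NNReal.coe_div, coe_nnnorm, Real.norm_eq_abs, div_pow, sq_abs]
    norm_num
    ring
  rw [← hX]
  exact measureReal_le_abs_empMean_le hindep (fun i =>
    hasSubgaussianMGF_of_mem_Icc_of_integral_eq_zero (hmeas i)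
      ((hbound i).mono fun _ => abs_le.mp) (hmean i)) hu

end Hoeffding

section Propensity

variable {𝓧 : Type*} [MeasurableSpace 𝓧] {T : ℕ} (P : Measure (𝓧 × Fin (T + 1)))
  [IsFiniteMeasure P]

theorem measurable_propensity (t : Fin (T + 1)) : Measurable (propensity P t) :=
  (Kernel.measurable_coe P.condKernel (measurableSet_singleton t)).ennreal_toReal

theorem propensity_nonneg (t : Fin (T + 1)) (x : 𝓧) : 0 ≤ propensity P t x :=
  measureReal_nonneg

theorem sum_propensity (x : 𝓧) : ∑ t, propensity P t x = 1 := by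
  simp only [propensity]
  rw [sum_measureReal_singleton, Finset.coe_univ, probReal_univ]

theorem propensity_le_one (t : Fin (T + 1)) (x : 𝓧) : propensity P t x ≤ 1 :=
  measureReal_le_one

theorem one_sub_sum_propensity_succ (x : 𝓧) :
    1 - ∑ t : Fin T, propensity P t.succ x = propensity P 0 x := by
  rw [← sum_propensity P x, Fin.sum_univ_succ, add_sub_cancel_right]

theorem integral_indicator_condKernel (t : Fin (T + 1)) (x : 𝓧) :
    ∫ y, (if y = t then (1 : ℝ) else 0) ∂P.condKernel x = propensity P t x := by
  rw [propensity, ← integral_indicator_one (measurableSet_singleton t)]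
  simp only [Set.indicator_apply, Set.mem_singleton_iff, Pi.one_apply]

end Propensity

section Marginal

variable {α β : Type*} [MeasurableSpace α] [MeasurableSpace β] {P : Measure (α × β)} {q : α → Prop}

theorem ae_of_ae_fst (h : ∀ᵐ x ∂P.fst, q x) : ∀ᵐ z ∂P, q z.1 :=
  ae_of_ae_map measurable_fst.aemeasurable h

theorem ae_of_ae_fst_of_map_eq {Ω : Type*} [MeasurableSpace Ω] {μ : Measure Ω} {Z : Ω → α × β}
    (hZ : Measurable Z) (hlaw : μ.map Z = P) (h : ∀ᵐ x ∂P.fst, q x) : ∀ᵐ ω ∂μ, q (Z ω).1 :=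
  ae_of_ae_map hZ.aemeasurable (hlaw ▸ ae_of_ae_fst h)

end Marginal

section Score

variable {𝓧 : Type*} [MeasurableSpace 𝓧] {T p : ℕ} (P : Measure (𝓧 × Fin (T + 1)))
  [IsFiniteMeasure P] {R : 𝓧 → Fin p → ℝ} {X : ℝ}

/-- The contribution `R(x)_j (1{d = t} - p_t(x))` of an observation `z = (x, d)` to the score. -/
noncomputable def scoreTerm (R : 𝓧 → Fin p → ℝ) (t : Fin T) (j : Fin p)
    (z : 𝓧 × Fin (T + 1)) : ℝ :=
  R z.1 j * ((if z.2 = t.succ then 1 else 0) - propensity P t.succ z.1)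

theorem measurable_scoreTerm (hR : Measurable R) (t : Fin T) (j : Fin p) :
    Measurable (scoreTerm P R t j) := by
  have hcovariate : Measurable fun z : 𝓧 × Fin (T + 1) => R z.1 j :=
    (measurable_pi_apply j).comp (hR.comp measurable_fst)
  have htreatment : Measurable fun z : 𝓧 × Fin (T + 1) => if z.2 = t.succ then (1 : ℝ) else 0 :=
    Measurable.ite (measurable_snd (measurableSet_singleton t.succ)) measurable_const
      measurable_const
  exact hcovariate.mul (htreatment.sub ((measurable_propensity P t.succ).comp measurable_fst))

theorem abs_scoreTerm_le {z : 𝓧 × Fin (T + 1)} {j : Fin p} (hz : |R z.1 j| ≤ X) (t : Fin T) :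
    |scoreTerm P R t j z| ≤ X := by
  rw [scoreTerm, abs_mul]
  refine (mul_le_of_le_one_right (abs_nonneg _) ?_).trans hz
  have hnonneg := propensity_nonneg P t.succ z.1
  have hle_one := propensity_le_one P t.succ z.1
  rw [abs_le]
  split_ifs <;> constructor <;> linarith

theorem integral_scoreTerm (hR : Measurable R) (hX : ∀ᵐ x ∂P.fst, ∀ j, |R x j| ≤ X) (t : Fin T)
    (j : Fin p) : ∫ z, scoreTerm P R t j z ∂P = 0 := by
  have hscore_int : Integrable (scoreTerm P R t j) P :=
    Integrable.of_bound (measurable_scoreTerm P hR t j).aestronglyMeasurable X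
      ((ae_of_ae_fst hX).mono fun z hz => abs_scoreTerm_le P (hz j) t)
  rw [← Measure.integral_condKernel hscore_int]
  refine integral_eq_zero_of_ae (Eventually.of_forall fun x => ?_)
  simp only [scoreTerm, Pi.zero_apply]
  rw [integral_const_mul, integral_sub Integrable.of_finite (integrable_const _),
    integral_indicator_condKernel, integral_const, probReal_univ, one_smul, sub_self, mul_zero]

variable {Ω : Type*} [MeasurableSpace Ω] {μ : Measure Ω} {n : ℕ} {Z : Fin n → Ω → 𝓧 × Fin (T + 1)}

theorem measureReal_le_abs_score_le (hR : Measurable R) (hX : ∀ᵐ x ∂P.fst, ∀ j, |R x j| ≤ X)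
    (hZ : ∀ i, Measurable (Z i)) (hlaw : ∀ i, μ.map (Z i) = P) (hindep : iIndepFun Z μ) {u : ℝ}
    (hu : 0 ≤ u) (t : Fin T) (j : Fin p) :
    μ.real {ω | u ≤ |score (fun i => R (Z i ω).1) (fun i => (Z i ω).2)
        (fun i t => propensity P t.succ (Z i ω).1) t j|}
      ≤ 2 * Real.exp (-(n * u ^ 2 / (2 * X ^ 2))) := by
  have hmeas := measurable_scoreTerm P hR t j
  refine measureReal_le_abs_empMean_le_of_abs_le (Y := fun i ω => scoreTerm P R t j (Z i ω))
    (hindep.comp (fun _ => scoreTerm P R t j) fun _ => hmeas)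
    (fun i => (hmeas.comp (hZ i)).aemeasurable) (fun i => ?_) (fun i => ?_) hu
  · filter_upwards [ae_of_ae_fst_of_map_eq (hZ i) (hlaw i) hX] with ω hω
    exact abs_scoreTerm_le P (hω j) t
  · rw [← integral_map (hZ i).aemeasurable hmeas.aestronglyMeasurable, hlaw i,
      integral_scoreTerm P hR hX]

theorem measureReal_exists_lt_colNorm_score_le (hR : Measurable R)
    (hX : ∀ᵐ x ∂P.fst, ∀ j, |R x j| ≤ X) (hZ : ∀ i, Measurable (Z i))
    (hlaw : ∀ i, μ.map (Z i) = P) (hindep : iIndepFun Z μ) {u : ℝ} (hu : 0 ≤ u) :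
    μ.real {ω | ∀ j, colNorm (score (fun i => R (Z i ω).1) (fun i => (Z i ω).2)
        fun i t => propensity P t.succ (Z i ω).1) j ≤ T * u}ᶜ
      ≤ T * (p * (2 * Real.exp (-(n * u ^ 2 / (2 * X ^ 2))))) := by
  have := hindep.isProbabilityMeasure
  set E : Fin T → Fin p → Set Ω := fun t j => {ω | u ≤ |score (fun i => R (Z i ω).1)
    (fun i => (Z i ω).2) (fun i t => propensity P t.succ (Z i ω).1) t j|}
  have hsubset : {ω | ∀ j, colNorm (score (fun i => R (Z i ω).1) (fun i => (Z i ω).2)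
      fun i t => propensity P t.succ (Z i ω).1) j ≤ T * u}ᶜ ⊆ ⋃ t, ⋃ j, E t j := by
    refine Set.compl_subset_comm.mp fun ω hω j => (colNorm_le_sum_abs _ j).trans ?_
    simp only [E, Set.mem_compl_iff, Set.mem_iUnion, Set.mem_ofPred_eq, not_exists, not_le] at hω
    exact (Finset.sum_le_card_nsmul _ _ _ fun t _ => (hω t j).le).trans_eq (by simp)
  calc _ ≤ μ.real (⋃ t, ⋃ j, E t j) := measureReal_mono hsubset
    _ ≤ ∑ _t : Fin T, ∑ _j : Fin p, 2 * Real.exp (-(n * u ^ 2 / (2 * X ^ 2))) :=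
        (measureReal_iUnion_fintype_le _).trans (Finset.sum_le_sum fun t _ =>
          (measureReal_iUnion_fintype_le _).trans (Finset.sum_le_sum fun j _ =>
            measureReal_le_abs_score_le P hR hX hZ hlaw hindep hu t j))
    _ = _ := by simp

end Score

/-! ### The penalty level -/

section Penalty

variable {xbar δ : ℝ} {T n p : ℕ}

theorem log_max_rpow_nonneg (p n : ℕ) (a : ℝ) : 0 ≤ Real.log (max p n : ℕ) ^ a :=
  Real.rpow_nonneg (Real.log_natCast_nonneg _) _

theorem penalty_nonneg (hxbar : 0 ≤ xbar) : 0 ≤ penalty xbar δ T n p := by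
  unfold penalty
  positivity

theorem sq_penalty (xbar δ : ℝ) (T n p : ℕ) :
    penalty xbar δ T n p ^ 2 = 4 * xbar ^ 2 * T / n
      * (1 + Real.log (max p n : ℕ) ^ (3 / 2 + δ) / Real.sqrt T) := by
  have hlog := log_max_rpow_nonneg p n (3 / 2 + δ)
  rw [penalty, mul_pow, Real.sq_sqrt (by positivity), div_pow, mul_pow,
    Real.sq_sqrt (Nat.cast_nonneg _), Real.sq_sqrt (Nat.cast_nonneg _)]
  ring

theorem two_mul_div_sqrt_le_penalty (δ : ℝ) (n p : ℕ) (hxbar : 0 ≤ xbar) (hT : 1 ≤ T) :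
    2 * xbar / Real.sqrt n ≤ penalty xbar δ T n p := by
  have hlog := log_max_rpow_nonneg p n (3 / 2 + δ)
  have hT_sqrt : 1 ≤ Real.sqrt T := Real.one_le_sqrt.mpr (by exact_mod_cast hT)
  have hfactor : 1 ≤ Real.sqrt (1 + Real.log (max p n : ℕ) ^ (3 / 2 + δ) / Real.sqrt T) :=
    Real.one_le_sqrt.mpr (le_add_of_nonneg_right (by positivity))
  calc 2 * xbar / Real.sqrt n = 2 * xbar * 1 / Real.sqrt n * 1 := by ring
    _ ≤ penalty xbar δ T n p := by
        unfold penalty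
        gcongr

theorem tendsto_log_max (p : ℕ → ℕ) :
    Tendsto (fun n => Real.log (max (p n) n : ℕ)) atTop atTop :=
  Real.tendsto_log_atTop.comp (tendsto_natCast_atTop_atTop.comp
    (tendsto_atTop_mono (fun n => le_max_right (p n) n) tendsto_id))

theorem eventually_sq_penalty_le (xbar : ℝ) (hδ : 0 ≤ 3 / 2 + δ) (hT : 1 ≤ T) (p : ℕ → ℕ) :
    ∀ᶠ n in atTop, penalty xbar δ T n (p n) ^ 2
      ≤ 8 * xbar ^ 2 * T * ((n : ℝ)⁻¹ * Real.log (max (p n) n : ℕ) ^ (3 / 2 + δ)) := by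
  have hT_sqrt : 1 ≤ Real.sqrt T := Real.one_le_sqrt.mpr (by exact_mod_cast hT)
  filter_upwards [(tendsto_log_max p).eventually_ge_atTop 1] with n hn
  rw [sq_penalty]
  set ℓ := Real.log (max (p n) n : ℕ) ^ (3 / 2 + δ)
  have hone : 1 ≤ ℓ := Real.one_le_rpow hn hδ
  calc 4 * xbar ^ 2 * T / n * (1 + ℓ / Real.sqrt T) ≤ 4 * xbar ^ 2 * T / n * (ℓ + ℓ) := by
        gcongr
        exact div_le_self (zero_le_one.trans hone) hT_sqrt
    _ = 8 * xbar ^ 2 * T * ((n : ℝ)⁻¹ * ℓ) := by ring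

theorem eventually_mul_log_max_le_mul_sq_penalty (hxbar : 0 < xbar) (hδ : -(1 / 2) < δ)
    (hT : 1 ≤ T) (p : ℕ → ℕ) (A : ℝ) :
    ∀ᶠ n in atTop, A * Real.log (max (p n) n : ℕ) ≤ n * penalty xbar δ T n (p n) ^ 2 := by
  have hT_pos : (0 : ℝ) < T := by exact_mod_cast hT
  set a := 4 * xbar ^ 2 * T / Real.sqrt T with ha
  have ha_pos : 0 < a := by positivity
  have hpow : Tendsto (fun n => Real.log (max (p n) n : ℕ) ^ (1 / 2 + δ)) atTop atTop :=
    (tendsto_rpow_atTop (by linarith)).comp (tendsto_log_max p)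
  filter_upwards [(tendsto_log_max p).eventually_gt_atTop 0, hpow.eventually_ge_atTop (A / a),
    eventually_gt_atTop 0] with n hlog hA hn
  have hn_pos : (0 : ℝ) < n := by exact_mod_cast hn
  rw [sq_penalty]
  set l := Real.log (max (p n) n : ℕ)
  have hsplit : l ^ (3 / 2 + δ) = l ^ (1 / 2 + δ) * l := by
    rw [show 3 / 2 + δ = 1 / 2 + δ + 1 by ring, Real.rpow_add_one hlog.ne']
  calc A * l ≤ a * l ^ (1 / 2 + δ) * l := by
        gcongr
        exact (div_le_iff₀' ha_pos).mp hA
    _ = 4 * xbar ^ 2 * T * (0 + l ^ (3 / 2 + δ) / Real.sqrt T) := by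
        rw [hsplit, ha]
        ring
    _ ≤ 4 * xbar ^ 2 * T * (1 + l ^ (3 / 2 + δ) / Real.sqrt T) := by
        gcongr
        exact zero_le_one
    _ = n * (4 * xbar ^ 2 * T / n * (1 + l ^ (3 / 2 + δ) / Real.sqrt T)) := by field_simp

theorem tendsto_mul_exp_neg_mul_sq_penalty (hxbar : 0 < xbar) (hδ : -(1 / 2) < δ) (hT : 1 ≤ T)
    (p : ℕ → ℕ) {c : ℝ} (hc : 0 < c) :
    Tendsto (fun n => (p n : ℝ) * Real.exp (-(c * (n * penalty xbar δ T n (p n) ^ 2))))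
      atTop (𝓝 0) := by
  have hlim : Tendsto (fun n => Real.exp (-Real.log (max (p n) n : ℕ))) atTop (𝓝 0) :=
    Real.tendsto_exp_neg_atTop_nhds_zero.comp (tendsto_log_max p)
  refine tendsto_of_tendsto_of_tendsto_of_le_of_le' tendsto_const_nhds hlim
    (Eventually.of_forall fun n => by positivity) ?_
  filter_upwards [eventually_mul_log_max_le_mul_sq_penalty hxbar hδ hT p (2 / c),
    eventually_gt_atTop 0] with n hpenalty hn
  have hmax : (0 : ℝ) < (max (p n) n : ℕ) := by exact_mod_cast lt_max_of_lt_right hn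
  have hexponent : 2 * Real.log (max (p n) n : ℕ) ≤ c * (n * penalty xbar δ T n (p n) ^ 2) := by
    rwa [div_mul_eq_mul_div, div_le_iff₀' hc] at hpenalty
  calc (p n : ℝ) * Real.exp (-(c * (n * penalty xbar δ T n (p n) ^ 2)))
      ≤ Real.exp (Real.log (max (p n) n : ℕ)) * Real.exp (-(2 * Real.log (max (p n) n : ℕ))) := by
        rw [Real.exp_log hmax]
        gcongr
        exact le_max_left _ _
    _ = Real.exp (-Real.log (max (p n) n : ℕ)) := by
        rw [← Real.exp_add]
        ring_nf

theorem eventually_sq_penalty_mul_add_le (xbar : ℝ) (hδ : 0 ≤ 3 / 2 + δ)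
    (hT : 1 ≤ T) (p s : ℕ → ℕ) (b : ℕ → ℝ) :
    ∀ᶠ n in atTop, penalty xbar δ T n (p n) ^ 2 * s n + b n ^ 2
      ≤ (8 * xbar ^ 2 * T + 1)
        * ((n : ℝ)⁻¹ * s n * Real.log (max (p n) n : ℕ) ^ (3 / 2 + δ) + b n ^ 2) := by
  filter_upwards [eventually_sq_penalty_le xbar hδ hT p] with n hn
  have hlog := log_max_rpow_nonneg (p n) n (3 / 2 + δ)
  set ℓ := Real.log (max (p n) n : ℕ) ^ (3 / 2 + δ)
  calc penalty xbar δ T n (p n) ^ 2 * s n + b n ^ 2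
      ≤ 8 * xbar ^ 2 * T * ((n : ℝ)⁻¹ * ℓ) * s n + b n ^ 2 := by gcongr
    _ ≤ 8 * xbar ^ 2 * T * ((n : ℝ)⁻¹ * ℓ) * s n + b n ^ 2
        + ((n : ℝ)⁻¹ * s n * ℓ + 8 * xbar ^ 2 * T * b n ^ 2) :=
      le_add_of_nonneg_right (by positivity)
    _ = (8 * xbar ^ 2 * T + 1) * ((n : ℝ)⁻¹ * s n * ℓ + b n ^ 2) := by ring

theorem eventually_penalty_mul_add_le (xbar : ℝ) (hδ : 0 ≤ 3 / 2 + δ)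
    (hT : 1 ≤ T) (p s : ℕ → ℕ) {b : ℕ → ℝ} (hb : ∀ᶠ n in atTop, 0 ≤ b n) :
    ∀ᶠ n in atTop, penalty xbar δ T n (p n) * s n + b n * Real.sqrt (s n)
      ≤ (Real.sqrt (8 * xbar ^ 2 * T) + 1)
        * (Real.sqrt ((n : ℝ)⁻¹ * (s n : ℝ) ^ 2 * Real.log (max (p n) n : ℕ) ^ (3 / 2 + δ))
          + b n * Real.sqrt (s n)) := by
  filter_upwards [eventually_sq_penalty_le xbar hδ hT p, hb] with n hn hbn
  set ℓ := Real.log (max (p n) n : ℕ) ^ (3 / 2 + δ)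
  have hsqrt : penalty xbar δ T n (p n) * s n
      ≤ Real.sqrt (8 * xbar ^ 2 * T) * Real.sqrt ((n : ℝ)⁻¹ * (s n : ℝ) ^ 2 * ℓ) := by
    rw [← Real.sqrt_mul (by positivity)]
    refine Real.le_sqrt_of_sq_le ?_
    calc (penalty xbar δ T n (p n) * s n) ^ 2 = penalty xbar δ T n (p n) ^ 2 * (s n : ℝ) ^ 2 :=
          mul_pow _ _ _
      _ ≤ 8 * xbar ^ 2 * T * ((n : ℝ)⁻¹ * ℓ) * (s n : ℝ) ^ 2 := by gcongr
      _ = 8 * xbar ^ 2 * T * ((n : ℝ)⁻¹ * (s n : ℝ) ^ 2 * ℓ) := by ring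
  have hbias : 0 ≤ Real.sqrt (8 * xbar ^ 2 * T) * (b n * Real.sqrt (s n)) := by positivity
  linarith [Real.sqrt_nonneg ((n : ℝ)⁻¹ * (s n : ℝ) ^ 2 * ℓ)]

end Penalty

/-! ### The sample is regular with probability approaching one -/

section RegularSample

variable {T : ℕ} {p : ℕ → ℕ} {pmin xbar δ : ℝ} {𝓧 : ℕ → Type*} [∀ n, MeasurableSpace (𝓧 n)]
  (P : ∀ n, Measure (𝓧 n × Fin (T + 1))) [∀ n, IsProbabilityMeasure (P n)]
  {R : ∀ n, 𝓧 n → Fin (p n) → ℝ} {Ω : ℕ → Type*} [∀ n, MeasurableSpace (Ω n)]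
  {μ : ∀ n, Measure (Ω n)} {Z : ∀ n, Fin n → Ω n → 𝓧 n × Fin (T + 1)}

theorem wpa1_colNorm_score_le (hT : 1 ≤ T) (hxbar : 0 < xbar) (hδ : -(1 / 2) < δ)
    (hR : ∀ n, Measurable (R n)) (hbounded : ∀ n, ∀ᵐ x ∂(P n).fst, ∀ j, |R n x j| ≤ xbar)
    (hZ : ∀ n i, Measurable (Z n i)) (hlaw : ∀ n i, (μ n).map (Z n i) = P n)
    (hindep : ∀ n, iIndepFun (Z n) (μ n)) {c : ℝ} (hc : 0 < c) :
    WPA1 μ fun n => {ω | ∀ j, colNorm (score (fun i => R n (Z n i ω).1) (fun i => (Z n i ω).2)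
      fun i t => propensity (P n) t.succ (Z n i ω).1) j ≤ c * penalty xbar δ T n (p n)} := by
  have hT_pos : (0 : ℝ) < T := by exact_mod_cast hT
  have hlim := ENNReal.tendsto_ofReal (((tendsto_mul_exp_neg_mul_sq_penalty hxbar hδ hT p
    (show 0 < (c / T) ^ 2 / (2 * xbar ^ 2) by positivity)).const_mul 2).const_mul (T : ℝ))
  rw [mul_zero, mul_zero, ENNReal.ofReal_zero] at hlim
  refine tendsto_of_tendsto_of_tendsto_of_le_of_le tendsto_const_nhds hlim
    (fun _ => zero_le) fun n => ?_
  have := (hindep n).isProbabilityMeasure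
  have hlam := penalty_nonneg (δ := δ) (T := T) (n := n) (p := p n) hxbar.le
  have htail := measureReal_exists_lt_colNorm_score_le (P n) (hR n) (hbounded n) (hZ n) (hlaw n)
    (hindep n) (show 0 ≤ c / T * penalty xbar δ T n (p n) by positivity)
  rw [← mul_assoc, mul_div_cancel₀ c hT_pos.ne'] at htail
  refine (ENNReal.le_ofReal_iff_toReal_le (measure_ne_top _ _) (by positivity)).mpr
    (htail.trans_eq ?_)
  ring_nf

theorem wpa1_regularSample (hT : 1 ≤ T) (hpmin : 0 < pmin) (hxbar : 0 < xbar)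
    (hδ : -(1 / 2) < δ) (hR : ∀ n, Measurable (R n))
    (hoverlap : ∀ n, ∀ᵐ x ∂(P n).fst, ∀ t, pmin ≤ propensity (P n) t x)
    (hbounded : ∀ n, ∀ᵐ x ∂(P n).fst, ∀ j, |R n x j| ≤ xbar)
    (hZ : ∀ n i, Measurable (Z n i)) (hlaw : ∀ n i, (μ n).map (Z n i) = P n)
    (hindep : ∀ n, iIndepFun (Z n) (μ n)) {γstar : ∀ n, Fin T → Fin (p n) → ℝ} {b : ℕ → ℝ}
    (hbias : WPA1 μ fun n =>
      {ω | ∀ t, Real.sqrt (propensityMSE (P n) (R n) (fun i => Z n i ω) (γstar n) t) ≤ b n}) :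
    WPA1 μ fun n => {ω | RegularSample xbar pmin (penalty xbar δ T n (p n) / 8) (b n)
      (fun i => R n (Z n i ω).1) (fun i => (Z n i ω).2)
      (fun i t => propensity (P n) t.succ (Z n i ω).1) (γstar n)} := by
  have hcovariates : WPA1 μ fun n => {ω | ∀ i, (∀ j, |R n (Z n i ω).1 j| ≤ xbar) ∧
      ∀ t, pmin ≤ propensity (P n) t (Z n i ω).1} :=
    wpa1_of_ae fun n => ae_all_iff.mpr fun i =>
      ae_of_ae_fst_of_map_eq (hZ n i) (hlaw n i) ((hbounded n).and (hoverlap n))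
  have hscore := wpa1_colNorm_score_le P hT hxbar hδ hR hbounded hZ hlaw hindep
    (show (0 : ℝ) < 1 / 8 by norm_num)
  refine ((hcovariates.inter hscore).inter hbias).mono (Eventually.of_forall fun n => ?_)
  rintro ω ⟨⟨hcov, hsc⟩, hb⟩
  have hb_nonneg : 0 ≤ b n := (Real.sqrt_nonneg _).trans (hb ⟨0, hT⟩)
  exact
    { bound_nonneg := hxbar.le
      overlap_pos := hpmin
      bounded := fun i => (hcov i).1
      overlap := fun i t => (hcov i).2 t.succ
      overlap_baseline := fun i =>
        ((hcov i).2 0).trans_eq (one_sub_sum_propensity_succ (P n) _).symm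
      score_le := fun j => (hsc j).trans_eq (one_div_mul_eq_div _ _)
      bias_nonneg := hb_nonneg
      bias_le := fun t => (Real.sqrt_le_left hb_nonneg).mp (hb t) }

end RegularSample

/-! ### Rates -/

section Rates

variable {lam b r : ℕ → ℝ} {s : ℕ → ℕ}

theorem eventually_mul_lt_sqrt {a : ℝ} (ha : 0 < a)
    (hlam : ∀ n : ℕ, a / Real.sqrt n ≤ lam n) (hlams : Tendsto (fun n => lam n * s n) atTop (𝓝 0))
    (A : ℝ) : ∀ᶠ n : ℕ in atTop, A * s n < Real.sqrt n := by
  have hlim : Tendsto (fun n : ℕ => s n / Real.sqrt n) atTop (𝓝 0) := by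
    refine squeeze_zero (fun n => by positivity) (fun n => ?_)
      (by simpa only [zero_div] using hlams.div_const a)
    rw [le_div_iff₀ ha]
    calc s n / Real.sqrt n * a = a / Real.sqrt n * s n := by ring
      _ ≤ lam n * s n := by gcongr; exact hlam n
  have hlimA := hlim.const_mul A
  rw [mul_zero] at hlimA
  filter_upwards [hlimA.eventually_lt_const one_pos, eventually_gt_atTop 0] with n hn hn_pos
  rwa [← mul_div_assoc, div_lt_one (Real.sqrt_pos.mpr (by exact_mod_cast hn_pos))] at hn

theorem sqrt_natCast_le_self (k : ℕ) : Real.sqrt k ≤ k :=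
  Real.sqrt_le_iff.mpr ⟨k.cast_nonneg, by exact_mod_cast Nat.le_self_pow two_ne_zero k⟩

theorem tendsto_of_isBigO_mul_sqrt (hlam : ∀ n, 0 ≤ lam n)
    (hlams : Tendsto (fun n => lam n * s n) atTop (𝓝 0))
    (hb : b =O[atTop] fun n => lam n * Real.sqrt (s n)) : Tendsto b atTop (𝓝 0) :=
  hb.trans_tendsto (squeeze_zero (fun n => mul_nonneg (hlam n) (Real.sqrt_nonneg _))
    (fun n => mul_le_mul_of_nonneg_left (sqrt_natCast_le_self (s n)) (hlam n)) hlams)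

theorem tendsto_mul_sqrt_of_isBigO_mul_sqrt
    (hlams : Tendsto (fun n => lam n * s n) atTop (𝓝 0))
    (hb : b =O[atTop] fun n => lam n * Real.sqrt (s n)) :
    Tendsto (fun n => b n * Real.sqrt (s n)) atTop (𝓝 0) := by
  refine (hb.mul (isBigO_refl (fun n => Real.sqrt (s n)) atTop)).trans_tendsto ?_
  simpa only [mul_assoc, Real.mul_self_sqrt (Nat.cast_nonneg _)] using hlams

theorem exists_eventually_le_mul_of_isBigO {f : ℕ → ℝ} (hf : ∀ n, 0 ≤ f n) (hb : b =O[atTop] f) :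
    ∃ C : ℝ, 0 < C ∧ ∀ᶠ n in atTop, b n ≤ C * f n := by
  obtain ⟨C, hC, hbound⟩ := hb.exists_pos
  refine ⟨C, hC, hbound.bound.mono fun n hn => (Real.le_norm_self _).trans (hn.trans_eq ?_)⟩
  rw [Real.norm_of_nonneg (hf n)]

theorem eventually_mul_le_localRadius (T : ℕ) {pmin K : ℝ} (hpmin : 0 < pmin) (hK : 0 ≤ K)
    (hr : Tendsto r atTop (𝓝 0)) (N : ℝ) : ∀ᶠ n in atTop, N * r n ≤ localRadius T pmin K :=
  Tendsto.eventually_le_const (localRadius_pos T hpmin hK) (by simpa using hr.const_mul N)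

end Rates

/-! ### Sparsity of the group lasso -/

section Sparsity

variable {n T p s : ℕ} {x : Fin n → Fin p → ℝ} {d : Fin n → Fin (T + 1)}
  {π : Fin n → Fin T → ℝ} {γ γ' : Fin T → Fin p → ℝ} {X pmin lam b κ Cb : ℝ}

theorem RegularSample.mem_sparsityIndexSet {σ AK κ' L : ℝ}
    (hreg : RegularSample X pmin σ b x d π γ) (hn : 1 ≤ n)
    (hL : sparsityFactor T pmin AK κ' lam b s ≤ L) (hsmall : 8 * L * X * s < Real.sqrt n) :
    n ∈ sparsityIndexSet n T (gram x) pmin AK κ' lam b s := by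
  refine ⟨hn, le_rfl, ?_⟩
  have hfactor : 0 ≤ sparsityFactor T pmin AK κ' lam b s := by
    rw [sparsityFactor]
    positivity
  have hL_nonneg := hfactor.trans hL
  have hX := hreg.bound_nonneg
  have hn_pos : 0 < Real.sqrt n := Real.sqrt_pos.mpr (by exact_mod_cast hn)
  calc 8 * s * sparsityFactor T pmin AK κ' lam b s * sparseEigMaxCard (gram x) n
      ≤ 8 * s * sparsityFactor T pmin AK κ' lam b s * (X * Real.sqrt n) := by
        gcongr
        exact sparseEigMaxCard_le hX hreg.bounded n
    _ ≤ 8 * s * L * (X * Real.sqrt n) := by gcongr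
    _ = 8 * L * X * s * Real.sqrt n := by ring
    _ < Real.sqrt n * Real.sqrt n := by gcongr
    _ = n := Real.mul_self_sqrt n.cast_nonneg

/-- The ratio of the number of covariates selected by the group lasso to `s`, when the restricted
eigenvalue is at least `κ`, the bias at most `Cb λ √s`, and the sparse eigenvalue at most `φ`. -/
noncomputable def sparsityConst (T : ℕ) (pmin κ Cb φ : ℝ) : ℝ :=
  4 * φ ^ 2 * T
    * ((2 + 16 * errorConst pmin (2 * lassoConst T κ Cb + T) ^ 2) * (1 + Cb ^ 2))

theorem lassoConst_nonneg (T : ℕ) (hκ : 0 ≤ κ) (hCb : 0 ≤ Cb) : 0 ≤ lassoConst T κ Cb := by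
  rw [lassoConst]
  positivity

theorem RegularSample.card_suppUnion_groupLasso_le_sparsityConst_mul {φ : ℝ} {m : ℕ}
    (hreg : RegularSample X pmin (lam / 8) b x d π γ) (hs : (suppUnion γ).card = s)
    (hlam : 0 < lam) (h : IsGroupLasso x d lam γ') (hκ : 0 < κ)
    (hre : IsRestrictedEigenvalue T (gram x) (suppUnion γ) κ) (hCb : 0 ≤ Cb)
    (hb : b ≤ Cb * (lam * Real.sqrt s))
    (hloc : X * lassoConst T κ Cb * (lam * s + b * Real.sqrt s)
      ≤ localRadius T pmin (2 * lassoConst T κ Cb + T))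
    (hφ : sparseEigMaxCard (gram x) m ≤ φ) (hm : sparsityConst T pmin κ Cb φ * s < m) :
    ((suppUnion γ').card : ℝ) ≤ sparsityConst T pmin κ Cb φ * s := by
  refine hreg.card_suppUnion_groupLasso_le hlam h (fun t => ?_) hφ hm
  obtain ⟨δ, rfl⟩ : ∃ δ, γ' = γ + δ := ⟨γ' - γ, (add_sub_cancel _ _).symm⟩
  have hmix := hreg.mixedNormOn_groupLasso_le hs hlam h hκ hre hCb hb
  have hfit := hreg.fitNorm_groupLasso_le hlam.le h (lassoConst_nonneg T hκ.le hCb) hmix hloc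
  have hb_sq : b ^ 2 ≤ Cb ^ 2 * (lam ^ 2 * s) := by
    calc b ^ 2 ≤ (Cb * (lam * Real.sqrt s)) ^ 2 := pow_le_pow_left₀ hreg.bias_nonneg hb 2
      _ = Cb ^ 2 * (lam ^ 2 * s) := by rw [mul_pow, mul_pow, Real.sq_sqrt s.cast_nonneg]
  refine (hreg.fitMSE_le_of_fitNorm_le hfit t).trans ?_
  rw [mul_assoc]
  gcongr
  linarith

end Sparsity

section Asymptotics

variable {T : ℕ} {p s : ℕ → ℕ} {X pmin : ℝ} {lam b κ : ℕ → ℝ} {Ω : ℕ → Type*}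
  [∀ n, MeasurableSpace (Ω n)] {μ : ∀ n, Measure (Ω n)}
  {x : ∀ n, Ω n → Fin n → Fin (p n) → ℝ} {d : ∀ n, Ω n → Fin n → Fin (T + 1)}
  {π : ∀ n, Ω n → Fin n → Fin T → ℝ} {γstar : ∀ n, Fin T → Fin (p n) → ℝ}
  {γtilde γhat : ∀ n, Ω n → Fin T → Fin (p n) → ℝ} {Shat : ∀ n, Ω n → Finset (Fin (p n))}

-- The maximal `n`-sparse eigenvalue grows at most like `√n`, of which `s` is a vanishing fraction,
-- so the largest admissible index `m = n` belongs to the index set.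
theorem wpa1_sparseEigMaxCard_le {σ : ℕ → ℝ} {a κ₀ AK C : ℝ}
    (hreg : WPA1 μ fun n =>
      {ω | RegularSample X pmin (σ n) (b n) (x n ω) (d n ω) (π n ω) (γstar n)})
    (ha : 0 < a) (hlam : ∀ n : ℕ, a / Real.sqrt n ≤ lam n)
    (hlams : Tendsto (fun n => lam n * s n) atTop (𝓝 0))
    (hb : b =O[atTop] fun n => lam n * Real.sqrt (s n)) (hpmin : 0 < pmin) (hκ₀ : 0 < κ₀)
    (hκ : ∀ᶠ n in atTop, κ₀ ≤ κ n)
    (hmax : WPA1 μ fun n =>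
      {ω | ∀ m ∈ sparsityIndexSet n T (gram (x n ω)) pmin AK (κ n) (lam n) (b n) (s n),
        sparseEigMaxCard (gram (x n ω)) m ≤ C}) :
    WPA1 μ fun n => {ω | sparseEigMaxCard (gram (x n ω)) n ≤ C} := by
  have hlam_nonneg : ∀ n, 0 ≤ lam n := fun n =>
    (div_nonneg ha.le (Real.sqrt_nonneg _)).trans (hlam n)
  obtain ⟨Cb, hCb, hb_le⟩ := exists_eventually_le_mul_of_isBigO
    (fun n => mul_nonneg (hlam_nonneg n) (Real.sqrt_nonneg _)) hb
  refine (hreg.inter hmax).mono ?_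
  filter_upwards [hb_le, hκ, eventually_ge_atTop 1,
    (tendsto_of_isBigO_mul_sqrt hlam_nonneg hlams hb).eventually_le_const (half_pos hpmin),
    eventually_mul_lt_sqrt ha hlam hlams (8 * (T * ((2 / pmin) ^ (T + 1) * T * |AK|
      * (6 / κ₀ + 8 * Cb * Real.sqrt T) + Cb) ^ 2) * X)]
    with n hbn hκn hn hb_pmin hsmall
  rintro ω ⟨hregω, hmaxω⟩
  exact hmaxω n (hregω.mem_sparsityIndexSet hn (sparsityFactor_le AK hpmin hκ₀ hκn
    (hlam_nonneg n) hregω.bias_nonneg hb_pmin hCb.le hbn) hsmall)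

theorem isOP_card_suppUnion_groupLasso {a κ₀ φ : ℝ}
    (hreg : WPA1 μ fun n =>
      {ω | RegularSample X pmin (lam n / 8) (b n) (x n ω) (d n ω) (π n ω) (γstar n)})
    (hs : ∀ n, (suppUnion (γstar n)).card = s n)
    (ha : 0 < a) (hlam : ∀ n : ℕ, a / Real.sqrt n ≤ lam n)
    (hlams : Tendsto (fun n => lam n * s n) atTop (𝓝 0))
    (hb : b =O[atTop] fun n => lam n * Real.sqrt (s n)) (hpmin : 0 < pmin) (hκ₀ : 0 < κ₀)
    (hκ : ∀ᶠ n in atTop, κ₀ ≤ κ n)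
    (hre : WPA1 μ fun n =>
      {ω | IsRestrictedEigenvalue T (gram (x n ω)) (suppUnion (γstar n)) (κ n)})
    (hφ : WPA1 μ fun n => {ω | sparseEigMaxCard (gram (x n ω)) n ≤ φ})
    (hγtilde : ∀ n ω, IsGroupLasso (x n ω) (d n ω) (lam n) (γtilde n ω)) :
    IsOP μ (fun n ω => ((suppUnion (γtilde n ω)).card : ℝ)) (fun n => (s n : ℝ)) := by
  have hlam_nonneg : ∀ n, 0 ≤ lam n := fun n =>
    (div_nonneg ha.le (Real.sqrt_nonneg _)).trans (hlam n)
  obtain ⟨Cb, hCb, hb_le⟩ := exists_eventually_le_mul_of_isBigO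
    (fun n => mul_nonneg (hlam_nonneg n) (Real.sqrt_nonneg _)) hb
  have hrate : Tendsto (fun n => lam n * s n + b n * Real.sqrt (s n)) atTop (𝓝 0) := by
    simpa only [add_zero] using hlams.add (tendsto_mul_sqrt_of_isBigO_mul_sqrt hlams hb)
  have hL := lassoConst_nonneg T hκ₀.le hCb.le
  have hK : 0 ≤ sparsityConst T pmin κ₀ Cb φ := by
    rw [sparsityConst]
    positivity
  refine isOP_of_wpa1 (C := sparsityConst T pmin κ₀ Cb φ + 1) (by positivity)
    (((hreg.inter hre).inter hφ).mono ?_)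
  filter_upwards [hb_le, hκ, eventually_ge_atTop 1,
    eventually_mul_le_localRadius T hpmin (add_nonneg (mul_nonneg zero_le_two hL) T.cast_nonneg)
      hrate (X * lassoConst T κ₀ Cb),
    eventually_mul_lt_sqrt ha hlam hlams (sparsityConst T pmin κ₀ Cb φ)]
    with n hbn hκn hn hloc hsmall
  rintro ω ⟨⟨hregω, hreω⟩, hφω⟩
  have hn_pos : (0 : ℝ) < Real.sqrt n := Real.sqrt_pos.mpr (by exact_mod_cast hn)
  have hlam_pos : 0 < lam n := (by positivity : 0 < a / Real.sqrt n).trans_le (hlam n)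
  have hcard := hregω.card_suppUnion_groupLasso_le_sparsityConst_mul (hs n) hlam_pos
    (hγtilde n ω) hκ₀ (hreω.mono hκ₀.le hκn) hCb.le hbn hloc hφω
    (hsmall.trans_le (sqrt_natCast_le_self n))
  rw [Set.mem_ofPred_eq, Nat.abs_cast]
  exact hcard.trans (by gcongr; exact le_add_of_nonneg_right zero_le_one)

/-! ### Rates of the refit -/

theorem refitFactor_nonneg {L : ℝ} (T : ℕ) (pmin : ℝ) (hL : 0 ≤ L) : 0 ≤ refitFactor T pmin L := by
  have := (errorConst_pos pmin (show 0 ≤ 2 * L + T by positivity)).le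
  rw [refitFactor]
  positivity

section Refit

variable (hreg : WPA1 μ fun n =>
    {ω | RegularSample X pmin (lam n / 8) (b n) (x n ω) (d n ω) (π n ω) (γstar n)})
  (hs : ∀ n, (suppUnion (γstar n)).card = s n) (hlam : ∀ n, 0 ≤ lam n) (hpmin : 0 < pmin)
  (hrate : Tendsto (fun n => lam n * s n + b n * Real.sqrt (s n)) atTop (𝓝 0))
  (hγtilde : ∀ n ω, IsGroupLasso (x n ω) (d n ω) (lam n) (γtilde n ω))
  (hrefit : WPA1 μ fun n => {ω | suppUnion (γtilde n ω) ⊆ Shat n ω ∧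
    IsRefit (x n ω) (d n ω) (Shat n ω) (γhat n ω)})

include hreg hs hlam hpmin hrate hγtilde hrefit

theorem wpa1_refit_error_le {M c : ℝ} (hM : 0 ≤ M) (hc : 0 < c)
    (heig : WPA1 μ fun n => {ω | ∀ S : Finset (Fin (p n)), S.Nonempty →
      (S.card : ℝ) ≤ (M + 1) * s n → c ≤ sparseEigMin (gram (x n ω)) S}) :
    ∃ C L : ℝ, 0 < C ∧ 0 < L ∧ WPA1 μ fun n => {ω | RegularSample X pmin (lam n / 8) (b n)
      (x n ω) (d n ω) (π n ω) (γstar n) ∧ ((Shat n ω).card ≤ M * s n →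
        fitNorm (x n ω) (γhat n ω - γstar n) ≤ C * (lam n * Real.sqrt (s n) + b n) ∧
        mixedNormOn Finset.univ (γhat n ω - γstar n)
          ≤ L * Real.sqrt (s n) * fitNorm (x n ω) (γhat n ω - γstar n))} := by
  have hL : 0 < Real.sqrt (M + 1) / c := by positivity
  set L := Real.sqrt (M + 1) / c
  have hK := refitFactor_nonneg T pmin hL.le
  refine ⟨errorConst pmin (refitFactor T pmin L), L, errorConst_pos pmin hK, hL,
    ((hreg.inter heig).inter hrefit).mono ?_⟩
  filter_upwards [
    eventually_mul_le_localRadius T hpmin (show 0 ≤ 2 * L + T by positivity) hrate (X * L),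
    eventually_mul_le_localRadius T hpmin hK hrate (X * L)] with n hloc hloc'
  rintro ω ⟨⟨hregω, heigω⟩, hsub, hrefitω⟩
  refine ⟨hregω, fun hcard => ?_⟩
  have hlasso := hγtilde n ω
  rw [← add_sub_cancel (γstar n) (γtilde n ω)] at hlasso hsub
  rw [← add_sub_cancel (γstar n) (γhat n ω)] at hrefitω
  have hmix : ∀ ζ : Fin T → Fin (p n) → ℝ, suppUnion (γstar n + ζ) ⊆ Shat n ω →
      mixedNormOn Finset.univ ζ ≤ L * Real.sqrt (s n) * fitNorm (x n ω) ζ := fun ζ =>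
    mixedNormOn_univ_le_of_suppUnion_subset (hs n) hcard hM hc heigω
  exact ⟨hregω.fitNorm_refit_le (hlam n) hlasso hsub hrefitω hL.le hmix hloc hloc',
    hmix _ hrefitω.1⟩

variable (hmin : ∀ C : ℝ, 0 < C → ∃ c : ℝ, 0 < c ∧ WPA1 μ fun n =>
    {ω | ∀ S : Finset (Fin (p n)), S.Nonempty → (S.card : ℝ) ≤ C * s n →
      c ≤ sparseEigMin (gram (x n ω)) S})
  (hcard : IsOP μ (fun n ω => ((Shat n ω).card : ℝ)) (fun n => (s n : ℝ)))

include hmin hcard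

theorem isOP_fitMSE_refit (t : Fin T) :
    IsOP μ (fun n ω => fitMSE (x n ω) (π n ω) (γhat n ω) t)
      (fun n => lam n ^ 2 * s n + b n ^ 2) := by
  refine hcard.of_bound fun M hM => ?_
  obtain ⟨c, hc, heig⟩ := hmin (M + 1) (by positivity)
  obtain ⟨C, L, hC, -, herror⟩ :=
    wpa1_refit_error_le hreg hs hlam hpmin hrate hγtilde hrefit hM.le hc heig
  refine ⟨2 + 16 * C ^ 2, by positivity, herror.mono (Eventually.of_forall fun n ω hω hcardω => ?_)⟩
  rw [Nat.abs_cast] at hcardω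
  have hmse := hω.1.fitMSE_le_of_fitNorm_le (hω.2 hcardω).1 t
  rwa [add_sub_cancel, ← abs_of_nonneg (a := fitMSE _ _ _ _)
    (empMean_nonneg fun i => sq_nonneg _)] at hmse

theorem isOP_mixedNormOn_refit_sub :
    IsOP μ (fun n ω => mixedNormOn Finset.univ (γhat n ω - γstar n))
      (fun n => lam n * s n + b n * Real.sqrt (s n)) := by
  refine hcard.of_bound fun M hM => ?_
  obtain ⟨c, hc, heig⟩ := hmin (M + 1) (by positivity)
  obtain ⟨C, L, hC, hL, herror⟩ :=
    wpa1_refit_error_le hreg hs hlam hpmin hrate hγtilde hrefit hM.le hc heig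
  refine ⟨L * C, by positivity, herror.mono (Eventually.of_forall fun n ω hω hcardω => ?_)⟩
  rw [Nat.abs_cast] at hcardω
  obtain ⟨hfit, hmix⟩ := hω.2 hcardω
  rw [abs_of_nonneg (mixedNormOn_nonneg _ _)]
  calc mixedNormOn Finset.univ (γhat n ω - γstar n)
      ≤ L * Real.sqrt (s n) * (C * (lam n * Real.sqrt (s n) + b n)) := hmix.trans (by gcongr)
    _ = L * C * (lam n * (Real.sqrt (s n) * Real.sqrt (s n)) + b n * Real.sqrt (s n)) := by ring
    _ = L * C * (lam n * s n + b n * Real.sqrt (s n)) := by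
        rw [Real.mul_self_sqrt (s n).cast_nonneg]

theorem isOP_sum_abs_refit_sub (t : Fin T) :
    IsOP μ (fun n ω => ∑ j, |γhat n ω t j - γstar n t j|)
      (fun n => lam n * s n + b n * Real.sqrt (s n)) :=
  (isOP_mixedNormOn_refit_sub hreg hs hlam hpmin hrate hγtilde hrefit hmin hcard).of_abs_le
    fun n ω => (abs_of_nonneg (Finset.sum_nonneg fun _ _ => abs_nonneg _)).trans_le
      ((sum_abs_le_mixedNormOn (γhat n ω - γstar n) t).trans (le_abs_self _))

end Refit

theorem isOP_card_of_isOP_card_sdiff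
    (hsdiff : IsOP μ (fun n ω => ((Shat n ω \ suppUnion (γtilde n ω)).card : ℝ))
      (fun n => (s n : ℝ)))
    (hsupp : IsOP μ (fun n ω => ((suppUnion (γtilde n ω)).card : ℝ)) (fun n => (s n : ℝ))) :
    IsOP μ (fun n ω => ((Shat n ω).card : ℝ)) (fun n => (s n : ℝ)) :=
  (hsdiff.add hsupp).of_abs_le fun n ω => by
    rw [Nat.abs_cast]
    refine le_trans ?_ (le_abs_self _)
    exact_mod_cast Finset.card_le_card_sdiff_add_card

end Asymptotics

end GroupLassoMLogit

open GroupLassoMLogit in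
theorem mainTheorem11_general
    (T : ℕ) (hT : 1 ≤ T) (p : ℕ → ℕ)
    (pmin xbar δ : ℝ) (hpmin : 0 < pmin) (hxbar : 0 < xbar) (hδ : -(1 / 2) < δ)
    {𝓧 : ℕ → Type*} [∀ n, MeasurableSpace (𝓧 n)]
    (P : ∀ n, Measure (𝓧 n × Fin (T + 1))) [∀ n, IsProbabilityMeasure (P n)]
    (R : ∀ n, 𝓧 n → Fin (p n) → ℝ) (hR : ∀ n, Measurable (R n))
    (hoverlap : ∀ n, ∀ᵐ x ∂(P n).fst, ∀ t, pmin ≤ propensity (P n) t x)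
    (hbounded : ∀ n, ∀ᵐ x ∂(P n).fst, ∀ j, |R n x j| ≤ xbar)
    {Ω : ℕ → Type*} [∀ n, MeasurableSpace (Ω n)]
    (μ : ∀ n, Measure (Ω n)) [∀ n, IsProbabilityMeasure (μ n)]
    (Z : ∀ n, Fin n → Ω n → 𝓧 n × Fin (T + 1))
    (hZ : ∀ n i, Measurable (Z n i))
    (hlaw : ∀ n i, (μ n).map (Z n i) = P n)
    (hindep : ∀ n, iIndepFun (Z n) (μ n))
    (γstar : ∀ n, Fin T → Fin (p n) → ℝ) (s : ℕ → ℕ)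
    (hs : ∀ n, (suppUnion (γstar n)).card = s n)
    (b : ℕ → ℝ)
    (hbias : WPA1 μ fun n =>
      {ω | ∀ t, Real.sqrt (propensityMSE (P n) (R n) (fun i => Z n i ω) (γstar n) t) ≤ b n})
    (lam : ℕ → ℝ) (hlam : ∀ n, lam n = penalty xbar δ T n (p n))
    (hlams : Tendsto (fun n => lam n * s n) atTop (𝓝 0))
    (hbs : Tendsto (fun n => b n * Real.sqrt (s n)) atTop (𝓝 0))
    (x : ∀ n, Ω n → Fin n → Fin (p n) → ℝ) (hx : ∀ n ω i, x n ω i = R n (Z n i ω).1)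
    (Q : ∀ n, Ω n → Matrix (Fin (p n)) (Fin (p n)) ℝ) (hQ : ∀ n ω, Q n ω = gram (x n ω))
    (κ : ℕ → ℝ) (hκpos : ∃ c : ℝ, 0 < c ∧ ∀ᶠ n in atTop, c ≤ κ n)
    (hκ : WPA1 μ fun n =>
      {ω | IsRestrictedEigenvalue T (Q n ω) (suppUnion (γstar n)) (κ n)})
    (hmin : ∀ C : ℝ, 0 < C → ∃ c : ℝ, 0 < c ∧ WPA1 μ fun n =>
      {ω | ∀ S : Finset (Fin (p n)), S.Nonempty → (S.card : ℝ) ≤ C * s n →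
        c ≤ sparseEigMin (Q n ω) S})
    (AK : ℝ)
    (hmax : ∃ C : ℝ, WPA1 μ fun n =>
      {ω | ∀ m ∈ sparsityIndexSet n T (Q n ω) pmin AK (κ n) (lam n) (b n) (s n),
        sparseEigMaxCard (Q n ω) m ≤ C})
    (γtilde : ∀ n, Ω n → Fin T → Fin (p n) → ℝ)
    (hγtilde : ∀ n ω,
      IsGroupLasso (x n ω) (fun i => (Z n i ω).2) (lam n) (γtilde n ω)) :
    ((b =O[atTop] fun n => lam n * Real.sqrt (s n)) →
      IsOP μ (fun n ω => ((suppUnion (γtilde n ω)).card : ℝ)) (fun n => (s n : ℝ))) ∧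
    (∀ (Shat : ∀ n, Ω n → Finset (Fin (p n))) (γhat : ∀ n, Ω n → Fin T → Fin (p n) → ℝ),
      (WPA1 μ fun n => {ω | suppUnion (γtilde n ω) ⊆ Shat n ω ∧
        IsRefit (x n ω) (fun i => (Z n i ω).2) (Shat n ω) (γhat n ω)}) →
      (IsOP μ (fun n ω => ((Shat n ω).card : ℝ)) (fun n => (s n : ℝ)) ∨
        ((b =O[atTop] fun n => lam n * Real.sqrt (s n)) ∧
          IsOP μ (fun n ω => ((Shat n ω \ suppUnion (γtilde n ω)).card : ℝ))
            (fun n => (s n : ℝ)))) →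
      ∀ t : Fin T,
        IsOP μ (fun n ω => propensityMSE (P n) (R n) (fun i => Z n i ω) (γhat n ω) t)
          (fun n => (n : ℝ)⁻¹ * s n * Real.log (max (p n) n : ℕ) ^ (3 / 2 + δ) + b n ^ 2) ∧
        IsOP μ (fun n ω => ∑ j, |γhat n ω t j - γstar n t j|)
          (fun n =>
            Real.sqrt ((n : ℝ)⁻¹ * (s n : ℝ) ^ 2 * Real.log (max (p n) n : ℕ) ^ (3 / 2 + δ))
              + b n * Real.sqrt (s n))) := by
  obtain rfl : x = fun n ω i => R n (Z n i ω).1 :=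
    funext fun n => funext fun ω => funext (hx n ω)
  obtain rfl : Q = fun n ω => gram fun i => R n (Z n i ω).1 :=
    funext fun n => funext (hQ n)
  obtain rfl : lam = fun n => penalty xbar δ T n (p n) := funext hlam
  obtain ⟨κ₀, hκ₀, hκ_ge⟩ := hκpos
  obtain ⟨C, hmax⟩ := hmax
  have hreg := wpa1_regularSample P hT hpmin hxbar hδ hR hoverlap hbounded hZ hlaw hindep hbias
  have hlam_ge := fun n => two_mul_div_sqrt_le_penalty δ n (p n) hxbar.le hT
  have hlam_nonneg := fun n => penalty_nonneg (δ := δ) (T := T) (n := n) (p := p n) hxbar.le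
  have hsupp := fun hb => isOP_card_suppUnion_groupLasso hreg hs (by positivity) hlam_ge hlams hb
    hpmin hκ₀ hκ_ge hκ (wpa1_sparseEigMaxCard_le hreg (by positivity) hlam_ge hlams hb hpmin hκ₀
      hκ_ge hmax) hγtilde
  refine ⟨hsupp, fun Shat γhat hrefit hcard t => ?_⟩
  have hShat : IsOP μ (fun n ω => ((Shat n ω).card : ℝ)) (fun n => (s n : ℝ)) :=
    hcard.elim id fun h => isOP_card_of_isOP_card_sdiff h.2 (hsupp h.1)
  have hrate := by simpa only [add_zero] using hlams.add hbs
  have hb_nonneg : ∀ᶠ n in atTop, 0 ≤ b n :=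
    hreg.eventually_nonempty.mono fun _ ⟨_, hω⟩ => hω.bias_nonneg
  exact ⟨(isOP_fitMSE_refit hreg hs hlam_nonneg hpmin hrate hγtilde hrefit hmin hShat t).trans_le
      (by positivity) (eventually_sq_penalty_mul_add_le xbar (by linarith) hT p s b),
    (isOP_sum_abs_refit_sub hreg hs hlam_nonneg hpmin hrate hγtilde hrefit hmin hShat t).trans_le
      (by positivity) (eventually_penalty_mul_add_le xbar (by linarith) hT p s hb_nonneg)⟩

open GroupLassoMLogit in
theorem mainTheorem11
    -- number of nonbaseline treatments, covariate dimension, overlap and support bounds,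
    -- exponent in the penalty
    (T : ℕ) (hT : 1 ≤ T) (p : ℕ → ℕ)
    (pmin xbar δ : ℝ) (hpmin : 0 < pmin) (hxbar : 0 < xbar) (hδ : 0 < δ)
    -- the laws `P n` of `(X, D)` and the transformations `X* = R n X`
    {𝓧 : ℕ → Type*} [∀ n, MeasurableSpace (𝓧 n)]
    (P : ∀ n, Measure (𝓧 n × Fin (T + 1))) [∀ n, IsProbabilityMeasure (P n)]
    (R : ∀ n, 𝓧 n → Fin (p n) → ℝ) (hR : ∀ n, Measurable (R n))
    -- overlap and bounded covariates
    (hoverlap : ∀ n, ∀ᵐ x ∂(P n).fst, ∀ t, pmin ≤ propensity (P n) t x)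
    (hbounded : ∀ n, ∀ᵐ x ∂(P n).fst, ∀ j, |R n x j| ≤ xbar)
    -- i.i.d. samples of size `n` from `P n`
    {Ω : ℕ → Type*} [∀ n, MeasurableSpace (Ω n)]
    (μ : ∀ n, Measure (Ω n)) [∀ n, IsProbabilityMeasure (μ n)]
    (Z : ∀ n, Fin n → Ω n → 𝓧 n × Fin (T + 1))
    (hZ : ∀ n i, Measurable (Z n i))
    (hlaw : ∀ n i, (μ n).map (Z n i) = P n)
    (hindep : ∀ n, iIndepFun (Z n) (μ n))
    -- sparse approximation: coefficients `γstar n`, sparsity `s n`, bias bound `b n`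
    (γstar : ∀ n, Fin T → Fin (p n) → ℝ) (s : ℕ → ℕ)
    (hs : ∀ n, (suppUnion (γstar n)).card = s n)
    (b : ℕ → ℝ)
    (hbias : WPA1 μ fun n =>
      {ω | ∀ t, Real.sqrt (propensityMSE (P n) (R n) (fun i => Z n i ω) (γstar n) t) ≤ b n})
    -- the penalty level, and `λ s = o(1)`, `b √s = o(1)`
    (lam : ℕ → ℝ) (hlam : ∀ n, lam n = penalty xbar δ T n (p n))
    (hlams : Tendsto (fun n => lam n * s n) atTop (𝓝 0))
    (hbs : Tendsto (fun n => b n * Real.sqrt (s n)) atTop (𝓝 0))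
    -- the covariates of the sample and the empirical Gram matrix
    (x : ∀ n, Ω n → Fin n → Fin (p n) → ℝ) (hx : ∀ n ω i, x n ω i = R n (Z n i ω).1)
    (Q : ∀ n, Ω n → Matrix (Fin (p n)) (Fin (p n)) ℝ) (hQ : ∀ n ω, Q n ω = gram (x n ω))
    -- restricted eigenvalue bounded away from zero
    (κ : ℕ → ℝ) (hκpos : ∃ c : ℝ, 0 < c ∧ ∀ᶠ n in atTop, c ≤ κ n)
    (hκ : WPA1 μ fun n =>
      {ω | IsRestrictedEigenvalue T (Q n ω) (suppUnion (γstar n)) (κ n)})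
    -- minimal sparse eigenvalues over sets of size `O(s)` bounded away from zero
    (hmin : ∀ C : ℝ, 0 < C → ∃ c : ℝ, 0 < c ∧ WPA1 μ fun n =>
      {ω | ∀ S : Finset (Fin (p n)), S.Nonempty → (S.card : ℝ) ≤ C * s n →
        c ≤ sparseEigMin (Q n ω) S})
    -- maximal sparse eigenvalues bounded, uniformly over the index set
    (AK : ℝ) (hAK : 2 < AK)
    (hmax : ∃ C : ℝ, WPA1 μ fun n =>
      {ω | ∀ m ∈ sparsityIndexSet n T (Q n ω) pmin AK (κ n) (lam n) (b n) (s n),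
        sparseEigMaxCard (Q n ω) m ≤ C})
    -- the group lasso estimate
    (γtilde : ∀ n, Ω n → Fin T → Fin (p n) → ℝ)
    (hγtilde : ∀ n ω,
      IsGroupLasso (x n ω) (fun i => (Z n i ω).2) (lam n) (γtilde n ω)) :
    -- number of selected covariates
    ((b =O[atTop] fun n => lam n * Real.sqrt (s n)) →
      IsOP μ (fun n ω => ((suppUnion (γtilde n ω)).card : ℝ)) (fun n => (s n : ℝ))) ∧
    -- for each choice of the refitting set and each refit on it:
    (∀ (Shat : ∀ n, Ω n → Finset (Fin (p n))) (γhat : ∀ n, Ω n → Fin T → Fin (p n) → ℝ),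
      (WPA1 μ fun n => {ω | suppUnion (γtilde n ω) ⊆ Shat n ω ∧
        IsRefit (x n ω) (fun i => (Z n i ω).2) (Shat n ω) (γhat n ω)}) →
      (IsOP μ (fun n ω => ((Shat n ω).card : ℝ)) (fun n => (s n : ℝ)) ∨
        ((b =O[atTop] fun n => lam n * Real.sqrt (s n)) ∧
          IsOP μ (fun n ω => ((Shat n ω \ suppUnion (γtilde n ω)).card : ℝ))
            (fun n => (s n : ℝ)))) →
      ∀ t : Fin T,
        -- post-selection propensity error
        IsOP μ (fun n ω => propensityMSE (P n) (R n) (fun i => Z n i ω) (γhat n ω) t)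
          (fun n => (n : ℝ)⁻¹ * s n * Real.log (max (p n) n : ℕ) ^ (3 / 2 + δ) + b n ^ 2) ∧
        -- `ℓ₁` error of the coefficients
        IsOP μ (fun n ω => ∑ j, |γhat n ω t j - γstar n t j|)
          (fun n =>
            Real.sqrt ((n : ℝ)⁻¹ * (s n : ℝ) ^ 2 * Real.log (max (p n) n : ℕ) ^ (3 / 2 + δ))
              + b n * Real.sqrt (s n))) :=
  mainTheorem11_general T hT p pmin xbar δ hpmin hxbar (by linarith) P R hR hoverlap hbounded μ Z
    hZ hlaw hindep γstar s hs b hbias lam hlam hlams hbs x hx Q hQ κ hκpos hκ hmin AK hmax γtilde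
    hγtilde
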